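/- Throughout, $C^\infty$-manifolds are those of convenient calculus: sets with a smooth atlas of charts onto $c^\infty$-open subsets of convenient vector spaces (possibly infinite-dimensional), separated as arc-generated spaces. (For finite-dimensional manifolds these are the usual Hausdorff $C^\infty$-manifolds; paracompactness is not required.) Let $\dim M \in \{0,1,2,\dots,\infty\}$ denote the dimension of the vector spaces on which $M$ is modelled; if different parts of $M$ are modelled on spaces of different dimensions, $\dim M$ denotes the smallest of these (and $\dim \emptyset=\infty$). Regard $M$ as a diffeological space whose plots are the smooth maps $U \to M$ with $U \subseteq \mathbb{R}^n$ open, $n \ge 0$, and for an integer $d>0$ let $M_d$ be the set $M$ with the $d$-skeletal diffeology, i.e. the diffeology generated by the plots $U \to M$ with $U \subseteq \mathbb{R}^n$ open and $n \le d$. Smooth maps $f, g : X \to Y$ of diffeological spaces are smoothly homotopic if there is a smooth map $F : X \times \mathbb{R} \to Y$ with $F(\cdot,0)=f$ and $F(\cdot,1)=g$, where $X\times\mathbb{R}$ has the product diffeology; $X$ and $Y$ are smoothly homotopy equivalent if there are smooth maps $f : X \to Y$ and $g : Y \to X$ such that $g\circ f$ and $f \circ g$ are smoothly homotopic to $1_X$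 and $1_Y$. **Corollary 1.4.** Let $M$ and $N$ be $C^\infty$-manifolds and let $d$ be an integer with $0<d<\min(\dim M,\dim N)$. Then the following are equivalent: (i) $M_d$ is smoothly homotopy equivalent to $N_d$. (ii) $M_d$ is diffeomorphic to $N_d$ (as diffeological spaces). (iii) $M$ is diffeomorphic to $N$ (as $C^\infty$-manifolds). -/

import Mathlib

open Set Filter Topology
open scoped ContDiff Pointwise
open Diffeology

universe u v w u' v' w'

/-! ### Convenient vector spaces and smooth curves -/

section Convenient

/-- A curve `c : ℝ → E` in a topological vector space is smooth if all its iterated derivatives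
exist: `D n` is the `n`-th derivative of `c`. -/
def SmoothCurve {E : Type*} [AddCommGroup E] [Module ℝ E] [TopologicalSpace E]
    [ContinuousSMul ℝ E] (c : ℝ → E) : Prop :=
  ∃ D : ℕ → ℝ → E, D 0 = c ∧ ∀ n t, HasDerivAt (D n) (D (n + 1) t) t

/-- A sequence is Mackey-Cauchy if `x n - x m ∈ μ n m • B` for some bounded absolutely convex
set `B` and some real numbers `μ n m` that tend to `0` as `n, m → ∞`. -/
def MackeyCauchySeq {E : Type*} [AddCommGroup E] [Module ℝ E] [TopologicalSpace E]
    (x : ℕ → E) : Prop :=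
  ∃ (B : Set E) (μ : ℕ × ℕ → ℝ), Bornology.IsVonNBounded ℝ B ∧ AbsConvex ℝ B ∧
    Tendsto μ atTop (𝓝 0) ∧ ∀ n m, x n - x m ∈ μ (n, m) • B

/-- A convenient vector space: a Hausdorff locally convex real vector space in which every
Mackey-Cauchy sequence converges. -/
class ConvenientVectorSpace (E : Type*) [AddCommGroup E] [Module ℝ E] [TopologicalSpace E] :
    Prop extends IsTopologicalAddGroup E, ContinuousSMul ℝ E, LocallyConvexSpace ℝ E,
      T2Space E where
  mackey_complete : ∀ x : ℕ → E, MackeyCauchySeq x → ∃ a, Tendsto x atTop (𝓝 a)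

variable {E F : Type*} [AddCommGroup E] [Module ℝ E] [TopologicalSpace E] [ContinuousSMul ℝ E]
  [AddCommGroup F] [Module ℝ F] [TopologicalSpace F] [ContinuousSMul ℝ F]

/-- The `c^∞`-topology of `E` is the final topology for the smooth curves `ℝ → E`. -/
def IsCInftyOpen (W : Set E) : Prop :=
  ∀ c : ℝ → E, SmoothCurve c → IsOpen (c ⁻¹' W)

/-- A map defined on a (`c^∞`-open) set `W ⊆ E` is smooth if it maps smooth curves in `W` to
smooth curves. -/
def CInftySmoothOn (f : E → F) (W : Set E) : Prop :=
  ∀ c : ℝ → E, SmoothCurve c → (∀ t, c t ∈ W) → SmoothCurve (f ∘ c)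

theorem smoothCurve_const (a : E) : SmoothCurve (fun _ : ℝ => a) := by
  refine ⟨fun n _ => if n = 0 then a else 0, by simp, fun n t => ?_⟩
  simp only [Nat.add_eq_zero_iff, one_ne_zero, and_false, if_false]
  rw [hasDerivAt_iff_hasFDerivAt, hasFDerivAt_iff_isLittleOTVS]
  have h := Asymptotics.IsLittleOTVS.zero (𝕜 := ℝ) (E := E) (fun x' : ℝ => x' - t) (𝓝 t)
  simpa [Pi.zero_def] using h

end Convenient

/-- In a normed space, smooth curves are the curves of class `C^∞`. -/
theorem smoothCurve_iff_contDiff {E : Type*} [NormedAddCommGroup E] [NormedSpace ℝ E]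
    (c : ℝ → E) : SmoothCurve c ↔ ContDiff ℝ ∞ c := by
  constructor
  · rintro ⟨D, rfl, hD⟩
    have key : ∀ n k : ℕ, ContDiff ℝ n (D k) := by
      intro n
      induction n with
      | zero =>
        intro k
        exact contDiff_zero.2 (continuous_iff_continuousAt.2 fun t => (hD k t).continuousAt)
      | succ n ih =>
        intro k
        have hd : deriv (D k) = D (k + 1) := funext fun t => (hD k t).deriv
        have := (contDiff_succ_iff_deriv (n := (n : WithTop ℕ∞)) (f := D k)).2
          ⟨fun t => (hD k t).differentiableAt, by simp, by rw [hd]; exact ih (k + 1)⟩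
        exact_mod_cast this
    exact contDiff_infty.2 fun n => key n 0
  · intro h
    refine ⟨fun n => iteratedDeriv n c, by simp, fun n t => ?_⟩
    simp only [iteratedDeriv_succ]
    exact ((h.differentiable_iteratedDeriv n (by exact_mod_cast ENat.natCast_lt_top n)) t).hasDerivAt

/-- Euclidean spaces are convenient vector spaces. -/
instance euclideanConvenient (n : ℕ) : ConvenientVectorSpace (EuclideanSpace ℝ (Fin n)) where
  mackey_complete := by
    rintro x ⟨B, μ, hB, -, hμ, hx⟩
    apply cauchySeq_tendsto_of_complete
    obtain ⟨R, hR⟩ := (NormedSpace.isVonNBounded_iff' ℝ).1 hB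
    rw [cauchySeq_iff_tendsto_dist_atTop_0]
    have h0 : Tendsto (fun p => |μ p| * R) atTop (𝓝 0) := by
      simpa using (hμ.abs).mul_const R
    refine squeeze_zero (fun _ => dist_nonneg) (fun p => ?_) h0
    obtain ⟨b, hb, hbx⟩ := hx p.1 p.2
    simp only at hbx
    rw [dist_eq_norm, ← hbx, norm_smul, Real.norm_eq_abs]
    exact mul_le_mul_of_nonneg_left (hR b hb) (abs_nonneg _)

/-! ### Manifolds -/

/-- A `C^∞`-atlas on the set `carrier`: bijections from subsets that cover it onto `c^∞`-open
subsets of convenient vector spaces (which may vary with the chart), such that the chart changings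
are defined on `c^∞`-open sets and are smooth. -/
structure CInftyAtlas where
  carrier : Type u
  ι : Type v
  E : ι → Type w
  [addCommGroup : ∀ i, AddCommGroup (E i)]
  [module : ∀ i, Module ℝ (E i)]
  [topologicalSpace : ∀ i, TopologicalSpace (E i)]
  [convenient : ∀ i, ConvenientVectorSpace (E i)]
  chart : ∀ i, PartialEquiv carrier (E i)
  cover : ∀ x, ∃ i, x ∈ (chart i).source
  /-- For `i = j` this says that the image of a chart is `c^∞`-open. -/
  isCInftyOpen_overlap : ∀ i j,
    IsCInftyOpen (chart j '' ((chart i).source ∩ (chart j).source))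
  smooth_change : ∀ i j,
    CInftySmoothOn (chart i ∘ (chart j).symm) (chart j '' ((chart i).source ∩ (chart j).source))

attribute [instance] CInftyAtlas.addCommGroup CInftyAtlas.module CInftyAtlas.topologicalSpace
  CInftyAtlas.convenient

/-- The natural topology: `W` is open if its image in every chart is `c^∞`-open. -/
def CInftyAtlas.IsOpenSet (A : CInftyAtlas) (W : Set A.carrier) : Prop :=
  ∀ i, IsCInftyOpen (A.chart i '' (W ∩ (A.chart i).source))

/-- A curve that is continuous for the natural topology. -/
def CInftyAtlas.ContinuousCurve (A : CInftyAtlas) (c : ℝ → A.carrier) : Prop :=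
  ∀ W, A.IsOpenSet W → IsOpen (c ⁻¹' W)

/-- A `C^∞`-manifold in the sense of convenient calculus. It is separated as an arc-generated
space: the diagonal is closed in the arc-generated product, whose topology is the final one for
the pairs of continuous curves. -/
structure CInftyManifold extends CInftyAtlas.{u, v, w} where
  separated : ∀ c₁ c₂ : ℝ → carrier, toCInftyAtlas.ContinuousCurve c₁ →
    toCInftyAtlas.ContinuousCurve c₂ → IsClosed {t | c₁ t = c₂ t}

instance : CoeSort CInftyManifold (Type _) := ⟨fun M => M.carrier⟩

/-- A map of manifolds is smooth if around each point and for each chart of the target around the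
image point it is smooth in a chart of the source that it maps into the chart of the target.
(The chart of the source is the restriction to `W` of one in the given atlas.) -/
def CInftyManifold.Smooth {M N : CInftyManifold} (f : M → N) : Prop :=
  ∀ (x : M) (j : N.ι), f x ∈ (N.chart j).source →
    ∃ (i : M.ι) (W : Set M), x ∈ W ∧ W ⊆ (M.chart i).source ∧
      IsCInftyOpen (M.chart i '' W) ∧ MapsTo f W (N.chart j).source ∧
      CInftySmoothOn (N.chart j ∘ f ∘ (M.chart i).symm) (M.chart i '' W)

/-- `M` and `N` are diffeomorphic as manifolds. -/
def CInftyManifold.Diffeomorphic (M N : CInftyManifold) : Prop :=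
  ∃ e : M ≃ N, CInftyManifold.Smooth (e : M → N) ∧ CInftyManifold.Smooth (e.symm : N → M)

/-- The dimension of a manifold: the dimension of its model spaces, and the least of these
dimensions if there are different ones. Charts with empty domain do not count. -/
noncomputable def CInftyManifold.dim (M : CInftyManifold) : ℕ∞ :=
  ⨅ (i : M.ι) (_ : (M.chart i).source.Nonempty), Cardinal.toENat (Module.rank ℝ (M.E i))

theorem isCInftyOpen_of_isOpen {E : Type*} [NormedAddCommGroup E] [NormedSpace ℝ E] {W : Set E}
    (hW : IsOpen W) : IsCInftyOpen W := fun c hc =>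
  hW.preimage ((smoothCurve_iff_contDiff c).1 hc).continuous

/-- Euclidean space as a manifold, with the identity as its only chart. -/
def euclideanManifold (n : ℕ) : CInftyManifold where
  carrier := EuclideanSpace ℝ (Fin n)
  ι := Unit
  E _ := EuclideanSpace ℝ (Fin n)
  chart _ := PartialEquiv.refl _
  cover _ := ⟨(), mem_univ _⟩
  isCInftyOpen_overlap _ _ := by simpa using isCInftyOpen_of_isOpen isOpen_univ
  smooth_change _ _ := fun c hc _ => hc
  separated := by
    intro c₁ c₂ h₁ h₂
    have aux : ∀ c : ℝ → EuclideanSpace ℝ (Fin n),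
        (∀ W : Set (EuclideanSpace ℝ (Fin n)), (Unit → IsCInftyOpen (id '' (W ∩ univ))) →
          IsOpen (c ⁻¹' W)) → Continuous c := fun c hc =>
      continuous_def.2 fun W hW => hc W fun _ => by simpa using isCInftyOpen_of_isOpen hW
    exact isClosed_eq (aux c₁ h₁) (aux c₂ h₂)

theorem smooth_euclidean_iff {n : ℕ} {M : CInftyManifold} (p : EuclideanSpace ℝ (Fin n) → M) :
    CInftyManifold.Smooth (M := euclideanManifold n) p ↔
      ∀ (x : EuclideanSpace ℝ (Fin n)) (j : M.ι), p x ∈ (M.chart j).source →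
        ∃ W : Set (EuclideanSpace ℝ (Fin n)), x ∈ W ∧ IsCInftyOpen W ∧
          MapsTo p W (M.chart j).source ∧ CInftySmoothOn (M.chart j ∘ p) W := by
  constructor
  · intro h x j hx
    obtain ⟨i, W, hxW, -, hW, hpW, hs⟩ := h x j hx
    have e : (euclideanManifold n).chart i '' W = W := image_id W
    rw [e] at hW hs
    exact ⟨W, hxW, hW, hpW, hs⟩
  · intro h x j hx
    obtain ⟨W, hxW, hW, hpW, hs⟩ := h x j hx
    have e : (euclideanManifold n).chart () '' W = W := image_id W
    refine ⟨(), W, hxW, subset_univ _, ?_, hpW, ?_⟩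
    · rw [e]; exact hW
    · rw [e]; exact hs

/-- A manifold as a diffeological space: its plots are its smooth parametrizations. -/
instance CInftyManifold.diffeology (M : CInftyManifold) : DiffeologicalSpace M where
  plots n := {p | CInftyManifold.Smooth (M := euclideanManifold n) p}
  constant_plots {n} x := (smooth_euclidean_iff _).2 fun _ _ hx =>
    ⟨univ, mem_univ _, isCInftyOpen_of_isOpen isOpen_univ, fun _ _ => hx,
      fun _ _ _ => smoothCurve_const _⟩
  plot_reparam {n m p f} hp hf := by
    have hfc : ∀ c, SmoothCurve c → SmoothCurve (f ∘ c) := fun c hc =>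
      (smoothCurve_iff_contDiff _).2 (hf.comp ((smoothCurve_iff_contDiff c).1 hc))
    refine (smooth_euclidean_iff _).2 fun x j hx => ?_
    obtain ⟨W, hxW, hW, hpW, hs⟩ := (smooth_euclidean_iff p).1 hp (f x) j hx
    exact ⟨f ⁻¹' W, hxW, fun c hc => hW _ (hfc c hc), fun y hy => hpW hy,
      fun c hc hcW => hs (f ∘ c) (hfc c hc) hcW⟩
  locality {n p} hp := by
    refine (smooth_euclidean_iff _).2 fun x j hx => ?_
    obtain ⟨u, hu, hxu, hplot⟩ := hp x
    obtain ⟨r, hr, hru⟩ := Metric.isOpen_iff.1 hu x hxu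
    -- a smooth map into `u` that is the identity near `x`
    let χ : ContDiffBump x := ⟨r / 2, r, by positivity, by linarith⟩
    let f : EuclideanSpace ℝ (Fin n) → EuclideanSpace ℝ (Fin n) := fun y => x + χ y • (y - x)
    have hf : ContDiff ℝ ∞ f := contDiff_const.add (χ.contDiff.smul (contDiff_id.sub contDiff_const))
    have hfu : ∀ y, f y ∈ u := by
      intro y
      apply hru
      rw [Metric.mem_ball, dist_eq_norm]
      simp only [f, add_sub_cancel_left, norm_smul, Real.norm_eq_abs, abs_of_nonneg χ.nonneg]
      by_cases hy : y ∈ Metric.ball x r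
      · rw [Metric.mem_ball, dist_eq_norm] at hy
        calc χ y * ‖y - x‖ ≤ 1 * ‖y - x‖ := by
              gcongr
              exact χ.le_one
          _ < r := by simpa using hy
      · have h0 : χ y = 0 := χ.zero_of_le_dist (by simpa using hy)
        simpa [h0] using hr
    have hfid : ∀ y ∈ Metric.ball x (r / 2), f y = y := by
      intro y hy
      have h1 : χ y = 1 := χ.one_of_mem_closedBall (Metric.ball_subset_closedBall hy)
      simp [f, h1]
    have hx2 : x ∈ Metric.ball x (r / 2) := Metric.mem_ball_self (by positivity)
    obtain ⟨W, hxW, hW, hpW, hs⟩ := (smooth_euclidean_iff (p ∘ f)).1 (hplot hfu hf) x j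
      (by simpa [hfid x hx2] using hx)
    refine ⟨W ∩ Metric.ball x (r / 2), ⟨hxW, hx2⟩, ?_, ?_, ?_⟩
    · intro c hc
      exact (hW c hc).inter (isCInftyOpen_of_isOpen Metric.isOpen_ball c hc)
    · rintro y ⟨hyW, hy⟩
      simpa [hfid y hy] using hpW hyW
    · intro c hc hcW
      have e : (M.chart j ∘ p) ∘ c = (M.chart j ∘ p ∘ f) ∘ c := by
        funext t
        simp [hfid _ (hcW t).2]
      rw [e]
      exact hs c hc fun t => (hcW t).1

/-! ### Diffeological spaces -/

/-- The set `X` underlying the `d`-skeleton of a diffeological space `X`. -/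
def Skeleton (_ : ℕ) (X : Type*) : Type _ := X

/-- The `d`-skeletal diffeology: the one generated by the plots of `X` of dimension `≤ d`. -/
instance Skeleton.diffeology (d : ℕ) (X : Type*) [DiffeologicalSpace X] :
    DiffeologicalSpace (Skeleton d X) :=
  DiffeologicalSpace.generateFrom
    (X := X) {q : (n : ℕ) × (EuclideanSpace ℝ (Fin n) → X) | q.1 ≤ d ∧ IsPlot q.2}

/-- The product diffeology: a plot is a map whose two components are plots. -/
instance prodDiffeology (X Y : Type*) [DiffeologicalSpace X] [DiffeologicalSpace Y] :
    DiffeologicalSpace (X × Y) where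
  plots _ := {p | IsPlot (Prod.fst ∘ p) ∧ IsPlot (Prod.snd ∘ p)}
  constant_plots x := ⟨isPlot_const (x := x.1), isPlot_const (x := x.2)⟩
  plot_reparam hp hf := ⟨isPlot_reparam hp.1 hf, isPlot_reparam hp.2 hf⟩
  locality hp := by
    constructor
    · refine DiffeologicalSpace.locality fun x => ?_
      obtain ⟨u, hu, hxu, h⟩ := hp x
      exact ⟨u, hu, hxu, fun hfu hf => (h hfu hf).1⟩
    · refine DiffeologicalSpace.locality fun x => ?_
      obtain ⟨u, hu, hxu, h⟩ := hp x
      exact ⟨u, hu, hxu, fun hfu hf => (h hfu hf).2⟩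

section Homotopy

variable {X Y : Type*} [DiffeologicalSpace X] [DiffeologicalSpace Y]

/-- Smooth maps `f` and `g` are smoothly homotopic if there is a smooth map `F : X × ℝ → Y` with
`F (·, 0) = f` and `F (·, 1) = g`. -/
def SmoothlyHomotopic (f g : X → Y) : Prop :=
  ∃ F : X × ℝ → Y, DSmooth F ∧ (∀ x, F (x, 0) = f x) ∧ ∀ x, F (x, 1) = g x

end Homotopy

/-- Smooth homotopy equivalence of diffeological spaces. -/
def SmoothlyHomotopyEquivalent (X Y : Type*) [DiffeologicalSpace X] [DiffeologicalSpace Y] : Prop :=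
  ∃ (f : X → Y) (g : Y → X), DSmooth f ∧ DSmooth g ∧
    SmoothlyHomotopic (g ∘ f) id ∧ SmoothlyHomotopic (f ∘ g) id

/-- `X` and `Y` are diffeomorphic as diffeological spaces. -/
def DDiffeomorphic (X Y : Type*) [DiffeologicalSpace X] [DiffeologicalSpace Y] : Prop :=
  ∃ e : X ≃ Y, DSmooth e ∧ DSmooth e.symm

/-! ### Derivatives of curves in topological vector spaces -/

/-! The substance is (i) ⇒ (ii), through a rigidity statement (`homotopy_skeleton_eq_of_eq_id`): for
`0 < d < dim M`, a smooth homotopy `F` of `M_d` that ends at the identity is constant. Both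
homotopies of an equivalence are then constant, so the two maps are mutually inverse.

To prove rigidity at `x`, take `d + 1` independent directions in a chart and let `P : ℝ^(d+1) → M`
be affine in that chart near `0`. `P` has too many variables to be a plot of `M_d`, but freezing its
`k`-th coordinate leaves `d` variables. Using the freed coordinate as time in `G (u, τ) = F (P u,
τ)` gives a plot of `M_d` on `ℝ^(d+1)`. This plot factors locally through dimension at most `d`, so
its derivative has a kernel. Hence at every point of the chart domain the derivative of `G` kills,
for each `k`, a nonzero vector whose `k`-th coordinate vanishes. Where the derivative is injective
in `u`, these vectors are all proportional to a single `(b, 1)`, so `b = 0` and `∂G/∂τ = 0`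
(`zero_one_mem_of_exists_mem_apply_eq_zero`, `exists_ball_eq_of_fderiv_kernel`). The times at which
`G (·, τ)` and `P` have the same germ at `0` therefore form a clopen set, which contains `1`.

The argument differentiates `G` once, whereas smoothness is only known along curves. The first-order
part of Boman's theorem, `contDiff_one_of_contDiff_comp_curve`, bridges this. It is applied to
continuous linear functionals, which separate the points of the model spaces.

For (ii) ⇔ (iii): smooth maps preserve local factorizations of plots, and conversely the smooth
curves are plots of `M_d` because `d ≥ 1`, and they detect smoothness. -/

theorem HasDerivAt.tvs_congr {E : Type*} [AddCommGroup E] [Module ℝ E] [TopologicalSpace E]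
    [ContinuousSMul ℝ E]
    {f g : ℝ → E} {f' : E} {t : ℝ} (hf : HasDerivAt f f' t)
    (hfg : f =ᶠ[𝓝 t] g) : HasDerivAt g f' t := by
  rw [hasDerivAt_iff_hasFDerivAt, hasFDerivAt_iff_isLittleOTVS] at hf ⊢
  refine hf.congr' ?_ EventuallyEq.rfl
  filter_upwards [hfg] with s hs
  rw [hs, hfg.self_of_nhds]

section CurveDeriv

variable {E F : Type*} [AddCommGroup E] [Module ℝ E] [TopologicalSpace E]
  [IsTopologicalAddGroup E] [ContinuousSMul ℝ E]
  [AddCommGroup F] [Module ℝ F] [TopologicalSpace F]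
  [IsTopologicalAddGroup F] [ContinuousSMul ℝ F]

/-- Carathéodory's description of the derivative of a curve in a topological vector space. -/
theorem hasDerivAt_iff_exists_slope {f : ℝ → E} {f' : E} {t : ℝ} :
    HasDerivAt f f' t ↔
      ∃ q : ℝ → E, ContinuousAt q t ∧ q t = f' ∧ ∀ s, f s = f t + (s - t) • q s := by
  have h₀ : ∀ᶠ s in 𝓝 t, s - t = 0 →
      f s - f t - (ContinuousLinearMap.toSpanSingleton ℝ f') (s - t) = 0 :=
    Eventually.of_forall fun s hs => by
      rw [sub_eq_zero] at hs
      simp [hs]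
  rw [hasDerivAt_iff_hasFDerivAt, hasFDerivAt_iff_isLittleOTVS,
    Asymptotics.isLittleOTVS_iff_tendsto_inv_smul h₀]
  constructor
  · intro h
    refine ⟨fun s => f' + (s - t)⁻¹ • (f s - f t - (s - t) • f'), ?_, by simp, fun s => ?_⟩
    · have := (tendsto_const_nhds (x := f')).add h
      simpa [ContinuousAt] using this
    · rcases eq_or_ne s t with rfl | hs
      · simp
      · rw [smul_add, smul_inv_smul₀ (sub_ne_zero.2 hs)]
        abel
  · rintro ⟨q, hq, rfl, h⟩
    have h0 : Tendsto (fun s => q s - q t) (𝓝 t) (𝓝 0) := by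
      simpa using hq.tendsto.sub_const (q t)
    refine tendsto_def.2 fun U hU => ?_
    filter_upwards [h0 hU] with s hs
    rcases eq_or_ne s t with rfl | hst
    · simpa using mem_of_mem_nhds hU
    · have : (s - t)⁻¹ • (f s - f t - (s - t) • q t) = q s - q t := by
        rw [h s, add_sub_cancel_left, ← smul_sub, inv_smul_smul₀ (sub_ne_zero.2 hst)]
      simpa [this] using hs

theorem HasDerivAt.tvs_add {f g : ℝ → E} {f' g' : E} {t : ℝ} (hf : HasDerivAt f f' t)
    (hg : HasDerivAt g g' t) : HasDerivAt (fun s => f s + g s) (f' + g') t := by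
  obtain ⟨q, hq, rfl, h⟩ := hasDerivAt_iff_exists_slope.1 hf
  obtain ⟨r, hr, rfl, h'⟩ := hasDerivAt_iff_exists_slope.1 hg
  refine hasDerivAt_iff_exists_slope.2 ⟨fun s => q s + r s, hq.add hr, rfl, fun s => ?_⟩
  rw [h s, h' s, smul_add]
  abel

theorem HasDerivAt.tvs_smul {a : ℝ → ℝ} {f : ℝ → E} {a' : ℝ} {f' : E} {t : ℝ}
    (ha : HasDerivAt a a' t) (hf : HasDerivAt f f' t) :
    HasDerivAt (fun s => a s • f s) (a' • f t + a t • f') t := by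
  obtain ⟨q, hq, rfl, h⟩ := hasDerivAt_iff_exists_slope.1 hf
  obtain ⟨r, hr, rfl, h'⟩ := hasDerivAt_iff_exists_slope.1 ha
  have hfc : ContinuousAt f t := by
    have : f = fun s => f t + (s - t) • q s := funext h
    rw [this]
    exact continuousAt_const.add ((continuousAt_id.sub continuousAt_const).smul hq)
  refine hasDerivAt_iff_exists_slope.2 ⟨fun s => r s • f s + a t • q s,
    (hr.smul hfc).add (continuousAt_const.smul hq), rfl, fun s => ?_⟩
  have h1 : a s • f s = a t • f s + ((s - t) * r s) • f s := by
    rw [← add_smul, ← smul_eq_mul, ← h' s]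
  rw [h1, smul_add, smul_smul, ← add_assoc, add_right_comm, smul_comm (s - t) (a t), ← smul_add,
    ← h s]

theorem HasDerivAt.tvs_comp {φ : ℝ → ℝ} {f : ℝ → E} {φ' : ℝ} {f' : E} {t : ℝ}
    (hf : HasDerivAt f f' (φ t)) (hφ : HasDerivAt φ φ' t) :
    HasDerivAt (fun s => f (φ s)) (φ' • f') t := by
  obtain ⟨q, hq, rfl, h⟩ := hasDerivAt_iff_exists_slope.1 hf
  obtain ⟨r, hr, rfl, h'⟩ := hasDerivAt_iff_exists_slope.1 hφ
  refine hasDerivAt_iff_exists_slope.2 ⟨fun s => r s • q (φ s),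
    hr.smul (hq.comp hφ.continuousAt), rfl, fun s => ?_⟩
  rw [h (φ s), smul_smul, ← smul_eq_mul, ← sub_eq_of_eq_add' (h' s)]

theorem ContinuousLinearMap.hasDerivAt_tvs_comp (ℓ : E →L[ℝ] F) {f : ℝ → E} {f' : E} {t : ℝ}
    (hf : HasDerivAt f f' t) : HasDerivAt (fun s => ℓ (f s)) (ℓ f') t := by
  obtain ⟨q, hq, rfl, h⟩ := hasDerivAt_iff_exists_slope.1 hf
  refine hasDerivAt_iff_exists_slope.2 ⟨fun s => ℓ (q s), ℓ.continuous.continuousAt.comp hq, rfl,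
    fun s => ?_⟩
  rw [h s, map_add, map_smul]

theorem HasDerivAt.tvs_unique [LocallyConvexSpace ℝ E] [T2Space E] {f : ℝ → E} {a b : E} {t : ℝ}
    (ha : HasDerivAt f a t) (hb : HasDerivAt f b t) : a = b :=
  (SeparatingDual.eq_iff_forall_dual_eq (R := ℝ)).2 fun ℓ =>
    (ℓ.hasDerivAt_tvs_comp ha).unique (ℓ.hasDerivAt_tvs_comp hb)

end CurveDeriv

/-! ### Smooth curves -/

/-- A coinductive principle: choosing derivatives inside the class `P` over and over produces the
whole sequence of iterated derivatives. -/
theorem SmoothCurve.of_closed {E : Type*} [AddCommGroup E] [Module ℝ E] [TopologicalSpace E]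
    [ContinuousSMul ℝ E]
    {P : (ℝ → E) → Prop}
    (hP : ∀ c, P c → ∃ c', P c' ∧ ∀ t, HasDerivAt c (c' t) t) {c : ℝ → E} (hc : P c) :
    SmoothCurve c := by
  choose! D hD hD' using hP
  have h : ∀ n, P (D^[n] c) := fun n => by
    induction n with
    | zero => exact hc
    | succ n ih => rw [Function.iterate_succ_apply']; exact hD _ ih
  refine ⟨fun n => D^[n] c, rfl, fun n t => ?_⟩
  have := hD' _ (h n) t
  rwa [← Function.iterate_succ_apply' D] at this

section SmoothCurve

variable {E F : Type*} [AddCommGroup E] [Module ℝ E] [TopologicalSpace E]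
  [IsTopologicalAddGroup E] [ContinuousSMul ℝ E]
  [AddCommGroup F] [Module ℝ F] [TopologicalSpace F]
  [IsTopologicalAddGroup F] [ContinuousSMul ℝ F]

theorem SmoothCurve.comp_contDiff {c : ℝ → E} (hc : SmoothCurve c) {φ : ℝ → ℝ}
    (hφ : ContDiff ℝ ∞ φ) : SmoothCurve (c ∘ φ) := by
  obtain ⟨D, rfl, hD⟩ := hc
  -- By the product and chain rules, the span of the curves `a t • D k (φ t)` is closed under
  -- differentiation.
  let S : Set (ℝ → E) :=
    {f | ∃ (a : ℝ → ℝ) (k : ℕ), ContDiff ℝ ∞ a ∧ f = fun t => a t • D k (φ t)}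
  refine SmoothCurve.of_closed (P := fun c => c ∈ Submodule.span ℝ S) (fun c hc => ?_)
    (Submodule.subset_span ⟨fun _ => 1, 0, contDiff_const, by funext t; simp⟩)
  have hd : ∀ {a : ℝ → ℝ}, ContDiff ℝ ∞ a → ContDiff ℝ ∞ (deriv a) := fun ha =>
    (contDiff_infty_iff_deriv.1 ha).2
  have hd' : ∀ {a : ℝ → ℝ}, ContDiff ℝ ∞ a → ∀ t, HasDerivAt a (deriv a t) t := fun ha t =>
    ((contDiff_infty_iff_deriv.1 ha).1 t).hasDerivAt
  induction hc using Submodule.span_induction with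
  | mem f hf =>
    obtain ⟨a, k, ha, rfl⟩ := hf
    refine ⟨(fun t => deriv a t • D k (φ t)) + fun t => (a t * deriv φ t) • D (k + 1) (φ t),
      add_mem (Submodule.subset_span ⟨_, k, hd ha, rfl⟩)
        (Submodule.subset_span ⟨_, k + 1, ha.mul (hd hφ), rfl⟩), fun t => ?_⟩
    have := (hd' ha t).tvs_smul ((hD k (φ t)).tvs_comp (hd' hφ t))
    rwa [smul_smul] at this
  | zero =>
    refine ⟨0, zero_mem _, fun t => ?_⟩
    exact hasDerivAt_iff_exists_slope.2 ⟨0, continuousAt_const, rfl, by simp⟩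
  | add f g _ _ hf hg =>
    obtain ⟨f', hf', h⟩ := hf
    obtain ⟨g', hg', h'⟩ := hg
    exact ⟨f' + g', add_mem hf' hg', fun t => (h t).tvs_add (h' t)⟩
  | smul r f _ hf =>
    obtain ⟨f', hf', h⟩ := hf
    refine ⟨r • f', Submodule.smul_mem _ r hf', fun t => ?_⟩
    have := (hasDerivAt_const t r).tvs_smul (h t)
    rwa [zero_smul, zero_add] at this

theorem SmoothCurve.continuousLinearMap_comp {c : ℝ → E} (hc : SmoothCurve c) (ℓ : E →L[ℝ] F) :
    SmoothCurve (fun t => ℓ (c t)) := by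
  obtain ⟨D, rfl, hD⟩ := hc
  exact ⟨fun n t => ℓ (D n t), rfl, fun n t => ℓ.hasDerivAt_tvs_comp (hD n t)⟩

theorem SmoothCurve.contDiff_dual {c : ℝ → E} (hc : SmoothCurve c) (ℓ : E →L[ℝ] ℝ) :
    ContDiff ℝ ∞ (fun t => ℓ (c t)) :=
  (smoothCurve_iff_contDiff _).1 (hc.continuousLinearMap_comp ℓ)

theorem SmoothCurve.add {b c : ℝ → E} (hb : SmoothCurve b) (hc : SmoothCurve c) :
    SmoothCurve (fun t => b t + c t) := by
  obtain ⟨B, rfl, hB⟩ := hb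
  obtain ⟨C, rfl, hC⟩ := hc
  exact ⟨fun n t => B n t + C n t, rfl, fun n t => (hB n t).tvs_add (hC n t)⟩

/-- A curve that agrees near each point with a smooth curve is smooth. -/
theorem SmoothCurve.of_locally [LocallyConvexSpace ℝ E] [T2Space E] {c : ℝ → E}
    (h : ∀ t, ∃ b, SmoothCurve b ∧ c =ᶠ[𝓝 t] b) : SmoothCurve c := by
  refine SmoothCurve.of_closed (P := fun c => ∀ t, ∃ b, SmoothCurve b ∧ c =ᶠ[𝓝 t] b)
    (fun c hc => ?_) h
  choose b hb hcb using hc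
  choose D hD0 hD using hb
  have key : ∀ t, ∀ᶠ s in 𝓝 t, HasDerivAt c (D t 1 s) s := fun t => by
    filter_upwards [(hcb t).eventually_nhds] with s hs
    have := hD t 0 s
    rw [hD0] at this
    exact this.tvs_congr (EventuallyEq.symm hs)
  -- The derivative is assembled pointwise from the local models; uniqueness of derivatives makes it
  -- agree with `D t 1` near `t`.
  refine ⟨fun t => D t 1 t, fun t => ⟨D t 1, ⟨fun n => D t (n + 1), rfl, fun n => hD t (n + 1)⟩,
    ?_⟩, fun t => (key t).self_of_nhds⟩
  filter_upwards [key t] with s hs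
  exact (key s).self_of_nhds.tvs_unique hs

end SmoothCurve

/-- A smooth map into a given neighbourhood of a point that is the identity near the point. -/
theorem exists_contDiff_mapsTo_eventuallyEq_id {V : Type*} [NormedAddCommGroup V]
    [NormedSpace ℝ V] [HasContDiffBump V] {x : V} {s : Set V} (hs : s ∈ 𝓝 x) :
    ∃ ρ : V → V, ContDiff ℝ ∞ ρ ∧ (∀ y, ρ y ∈ s) ∧ ρ =ᶠ[𝓝 x] id := by
  obtain ⟨r, hr, hrs⟩ := Metric.mem_nhds_iff.1 hs
  let χ : ContDiffBump x := ⟨r / 2, r, by positivity, by linarith⟩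
  refine ⟨fun y => x + χ y • (y - x),
    contDiff_const.add (χ.contDiff.smul (contDiff_id.sub contDiff_const)), fun y => hrs ?_, ?_⟩
  · rw [Metric.mem_ball, dist_eq_norm, add_sub_cancel_left, norm_smul, Real.norm_eq_abs,
      abs_of_nonneg χ.nonneg]
    by_cases hy : y ∈ Metric.ball x r
    · rw [Metric.mem_ball, dist_eq_norm] at hy
      exact (mul_le_of_le_one_left (norm_nonneg _) χ.le_one).trans_lt hy
    · have h0 : χ y = 0 := χ.zero_of_le_dist (by simpa using hy)
      simpa [h0] using hr
  · filter_upwards [Metric.ball_mem_nhds x (half_pos hr)] with y hy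
    have h1 : χ y = 1 := χ.one_of_mem_closedBall (Metric.ball_subset_closedBall hy)
    simp [h1]

/-! ### Smooth curves through fast converging sequences -/

section SpecialCurve

variable {V : Type*} [NormedAddCommGroup V] [NormedSpace ℝ V]

/-- Bumps of radius `2^-(m+3)` about `2^-m` do not meet each other: near `2^-n` only the `n`-th term
of the series below survives. -/
theorem one_le_abs_two_pow_mul_sub {n m : ℕ} (hmn : m ≠ n) {t : ℝ}
    (ht : |t - (2 : ℝ)⁻¹ ^ n| < (2 : ℝ)⁻¹ ^ (n + 2)) :
    1 ≤ |2 ^ (m + 3) * (t - (2 : ℝ)⁻¹ ^ m)| := by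
  have hdist : ∀ {p q : ℕ}, p < q → (2 : ℝ)⁻¹ ^ q ≤ (2 : ℝ)⁻¹ ^ p / 2 := fun {p q} hpq => by
    calc (2 : ℝ)⁻¹ ^ q ≤ (2 : ℝ)⁻¹ ^ (p + 1) :=
          pow_le_pow_of_le_one (by norm_num) (by norm_num) hpq
      _ = _ := by rw [pow_succ]; ring
  have hm : (0 : ℝ) < 2⁻¹ ^ m := by positivity
  have hn : (0 : ℝ) < 2⁻¹ ^ n := by positivity
  have hn2 : (2 : ℝ)⁻¹ ^ (n + 2) = 2⁻¹ ^ n / 4 := by rw [pow_add]; ring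
  rw [hn2, abs_lt] at ht
  have h8 : (2 : ℝ) ^ (m + 3) = 8 * (2⁻¹ ^ m)⁻¹ := by rw [inv_pow, inv_inv, pow_add]; ring
  have key : (2 : ℝ)⁻¹ ^ m / 8 ≤ |t - 2⁻¹ ^ m| := by
    rcases lt_or_gt_of_ne hmn with h | h
    · have := hdist h
      rw [abs_sub_comm]
      exact le_trans (by linarith) (le_abs_self _)
    · have := hdist h
      exact le_trans (by linarith) (le_abs_self _)
  rw [abs_mul, abs_of_pos (by positivity : (0 : ℝ) < 2 ^ (m + 3)), h8]
  calc (1 : ℝ) = 8 * (2⁻¹ ^ m)⁻¹ * (2⁻¹ ^ m / 8) := by field_simp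
    _ ≤ _ := by gcongr

/-- The `k`-th derivative of the `n`-th term picks up `2^((n+3)k) = 8^k (2^k)^n`, which the
factorial absorbs: the majorants sum to an exponential series. -/
theorem contDiff_tsum_bump_smul [CompleteSpace V] {ψ : ℝ → ℝ} (hψ : ContDiff ℝ ∞ ψ)
    (hψ0 : ∀ s, 1 ≤ |s| → ψ s = 0) {w : ℕ → V} {K : ℝ} (hw : ∀ n, ‖w n‖ ≤ K / n.factorial) :
    ContDiff ℝ ∞ (fun t => ∑' n : ℕ, ψ (2 ^ (n + 3) * (t - (2 : ℝ)⁻¹ ^ n)) • w n) := by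
  have hcs : HasCompactSupport ψ := HasCompactSupport.intro (isCompact_Icc (a := (-1 : ℝ)) (b := 1))
    fun s hs => hψ0 s (by
      by_contra! h
      exact hs (abs_le.1 h.le))
  have hb : ∀ k : ℕ, ∃ C, ∀ s, ‖iteratedFDeriv ℝ k ψ s‖ ≤ C := fun k =>
    (hψ.continuous_iteratedFDeriv (by exact_mod_cast le_top)).bounded_above_of_compact_support
      (hcs.iteratedFDeriv k)
  choose C hC using hb
  refine contDiff_tsum (N := ⊤) (v := fun k n => (8 ^ k * C k * K) * ((2 ^ k) ^ n / n.factorial))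
    (fun n => ?_) (fun k _ => ?_) (fun k n t _ => ?_)
  · exact (hψ.comp (contDiff_const.mul (contDiff_id.sub contDiff_const))).smul contDiff_const
  · exact (Real.summable_pow_div_factorial _).mul_left _
  · have hg : ContDiff ℝ k fun s => ψ (2 ^ (n + 3) * s) :=
      (hψ.of_le (by exact_mod_cast le_top)).comp (contDiff_const.mul contDiff_id)
    have hg' : ContDiff ℝ k fun s => ψ (2 ^ (n + 3) * (s - (2 : ℝ)⁻¹ ^ n)) :=
      hg.comp (contDiff_id.sub contDiff_const)
    rw [norm_iteratedFDeriv_eq_norm_iteratedDeriv, iteratedDeriv_smul_const hg'.contDiffAt,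
      iteratedDeriv_comp_sub_const k (fun s => ψ (2 ^ (n + 3) * s)),
      iteratedDeriv_comp_const_mul (hψ.of_le (by exact_mod_cast le_top)), norm_smul, norm_mul,
      ← norm_iteratedFDeriv_eq_norm_iteratedDeriv]
    have hC0 : 0 ≤ C k := (norm_nonneg _).trans (hC k 0)
    calc _ ≤ ‖((2 : ℝ) ^ (n + 3)) ^ k‖ * C k * (K / n.factorial) := by
          gcongr
          · exact hC k _
          · exact hw n
      _ = _ := by
          rw [Real.norm_of_nonneg (by positivity), ← pow_mul, ← pow_mul,
            show (8 : ℝ) = 2 ^ 3 by norm_num, ← pow_mul, add_mul, pow_add, mul_comm k n]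
          ring

/-- A smooth curve that runs affinely through the terms of a fast converging sequence. -/
theorem exists_contDiff_curve_through [CompleteSpace V] {x : V} {y : ℕ → V}
    (hy : ∀ n, ‖y n - x‖ ≤ 1 / n.factorial) (v : V) :
    ∃ c : ℝ → V, ContDiff ℝ ∞ c ∧ c 0 = x ∧ ∀ n : ℕ, ∀ᶠ t in 𝓝 ((2 : ℝ)⁻¹ ^ n),
      c t = y n + ((t - (2 : ℝ)⁻¹ ^ n) * (1 / n.factorial)) • v := by
  let ψ : ContDiffBump (0 : ℝ) := ⟨1 / 2, 1, by norm_num, by norm_num⟩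
  have hψ0 : ∀ s, 1 ≤ |s| → ψ s = 0 := fun s hs => ψ.zero_of_le_dist (by simpa using hs)
  -- The bumps `ψ` place the curve at `y n`, and `θ` adds the linear motion; the factor
  -- `(2^(n+3))⁻¹` in `w` undoes the rescaling of the argument of `θ`.
  let θ : ℝ → ℝ := fun s => s * ψ s
  have hθ : ContDiff ℝ ∞ θ := contDiff_id.mul ψ.contDiff
  have hθ0 : ∀ s, 1 ≤ |s| → θ s = 0 := fun s hs => by simp [θ, hψ0 s hs]
  let w : ℕ → V := fun n => ((2 ^ (n + 3))⁻¹ * (1 / n.factorial) : ℝ) • v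
  have hw : ∀ n, ‖w n‖ ≤ ‖v‖ / n.factorial := fun n => by
    have h1 : ((2 : ℝ) ^ (n + 3))⁻¹ ≤ 1 := inv_le_one_of_one_le₀ (one_le_pow₀ (by norm_num))
    rw [norm_smul, Real.norm_of_nonneg (by positivity)]
    calc _ ≤ 1 * (1 / (n.factorial : ℝ)) * ‖v‖ := by gcongr
      _ = _ := by ring
  have h0 : ∀ n : ℕ, (1 : ℝ) ≤ |2 ^ (n + 3) * (0 - (2 : ℝ)⁻¹ ^ n)| := fun n => by
    rw [zero_sub, mul_neg, abs_neg, abs_of_pos (by positivity), pow_add, mul_right_comm, ← mul_pow]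
    norm_num
  refine ⟨fun t => x + (∑' n : ℕ, ψ (2 ^ (n + 3) * (t - (2 : ℝ)⁻¹ ^ n)) • (y n - x)
      + ∑' n : ℕ, θ (2 ^ (n + 3) * (t - (2 : ℝ)⁻¹ ^ n)) • w n),
    contDiff_const.add ((contDiff_tsum_bump_smul ψ.contDiff hψ0 hy).add
      (contDiff_tsum_bump_smul hθ hθ0 hw)), ?_, fun n => ?_⟩
  · simp only [hψ0 _ (h0 _), hθ0 _ (h0 _), zero_smul, tsum_zero, add_zero]
  -- Within `2^-(n+4)` the rescaled argument is at most `1/2`, where `ψ = 1`.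
  · have hev : ∀ᶠ t in 𝓝 ((2 : ℝ)⁻¹ ^ n), |t - (2 : ℝ)⁻¹ ^ n| < (2 : ℝ)⁻¹ ^ (n + 4) :=
      Metric.ball_mem_nhds _ (by positivity)
    filter_upwards [hev] with t ht
    have ht' : |t - (2 : ℝ)⁻¹ ^ n| < (2 : ℝ)⁻¹ ^ (n + 2) :=
      ht.trans_le (pow_le_pow_of_le_one (by norm_num) (by norm_num) (by omega))
    rw [tsum_eq_single n fun m hm => by rw [hψ0 _ (one_le_abs_two_pow_mul_sub hm ht'), zero_smul],
      tsum_eq_single n fun m hm => by rw [hθ0 _ (one_le_abs_two_pow_mul_sub hm ht'), zero_smul]]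
    have hψ1 : ψ (2 ^ (n + 3) * (t - (2 : ℝ)⁻¹ ^ n)) = 1 := by
      apply ψ.one_of_mem_closedBall
      rw [mem_closedBall_zero_iff, Real.norm_eq_abs, abs_mul, abs_of_pos (by positivity)]
      calc (2 : ℝ) ^ (n + 3) * |t - 2⁻¹ ^ n| ≤ 2 ^ (n + 3) * 2⁻¹ ^ (n + 4) := by gcongr
        _ = 1 / 2 := by
          rw [inv_pow, pow_succ 2 (n + 3)]
          field_simp
    simp only [θ, hψ1, mul_one, one_smul, w, smul_smul]
    rw [← add_assoc, add_sub_cancel]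
    congr 2
    field_simp

/-- A set that is open along smooth curves in a Banach space is open. -/
theorem isOpen_of_contDiff_preimage [CompleteSpace V] {W : Set V}
    (hW : ∀ c : ℝ → V, ContDiff ℝ ∞ c → IsOpen (c ⁻¹' W)) : IsOpen W := by
  rw [isOpen_iff_mem_nhds]
  intro x hx
  by_contra h
  have hex : ∀ n : ℕ, ∃ y, ‖y - x‖ ≤ 1 / (n.factorial : ℝ) ∧ y ∉ W := fun n => by
    by_contra! hn
    refine h (mem_of_superset (Metric.closedBall_mem_nhds x
      (by positivity : (0 : ℝ) < 1 / n.factorial)) fun y hy => hn y ?_)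
    rwa [← dist_eq_norm]
  choose y hy hyW using hex
  obtain ⟨c, hc, hc0, hcn⟩ := exists_contDiff_curve_through hy (0 : V)
  have h1 : c ⁻¹' W ∈ 𝓝 (0 : ℝ) := (hW c hc).mem_nhds (by simpa [hc0] using hx)
  have h2 : Tendsto (fun n : ℕ => (2 : ℝ)⁻¹ ^ n) atTop (𝓝 0) :=
    tendsto_pow_atTop_nhds_zero_of_lt_one (by norm_num) (by norm_num)
  obtain ⟨n, hn⟩ := (h2.eventually_mem h1).exists
  have := (hcn n).self_of_nhds
  simp only [sub_self, zero_mul, zero_smul, add_zero] at this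
  exact hyW n (by rw [← this]; exact hn)

/-- Iterated directional derivatives of functions that are smooth along smooth curves are locally
bounded. -/
theorem exists_eventually_abs_iteratedDeriv_le [CompleteSpace V] {f : V → ℝ}
    (hf : ∀ c : ℝ → V, ContDiff ℝ ∞ c → ContDiff ℝ ∞ (f ∘ c)) (k : ℕ) (v x : V) :
    ∃ B : ℝ, ∀ᶠ y in 𝓝 x, |iteratedDeriv k (fun s : ℝ => f (y + s • v)) 0| ≤ B := by
  by_contra! h
  -- The curve passes `y n` with velocity `v / n!`, which scales the `k`-th derivative by `(1 /
  -- n!)^k`. The threshold `n * n!^k` thus makes the `k`-th derivative of `f ∘ c` exceed `n` at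
  -- `2^-n`, contradicting boundedness on `[0, 1]`.
  have hex : ∀ n : ℕ, ∃ y, ‖y - x‖ ≤ 1 / (n.factorial : ℝ) ∧
      n * (n.factorial : ℝ) ^ k < |iteratedDeriv k (fun s : ℝ => f (y + s • v)) 0| := fun n => by
    by_contra! hn
    refine h (n * (n.factorial : ℝ) ^ k) (mem_of_superset (Metric.closedBall_mem_nhds x
      (by positivity : (0 : ℝ) < 1 / n.factorial)) fun y hy => not_lt.2 (hn y ?_))
    rwa [← dist_eq_norm]
  choose y hy hyk using hex
  obtain ⟨c, hc, -, hcn⟩ := exists_contDiff_curve_through hy v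
  obtain ⟨B, hB⟩ := (isCompact_Icc (a := (0 : ℝ)) (b := 1)).exists_bound_of_continuousOn
    ((hf c hc).continuous_iteratedDeriv k (by exact_mod_cast le_top)).continuousOn
  obtain ⟨n, hn⟩ := exists_nat_gt B
  have hn1 : (2 : ℝ)⁻¹ ^ n ∈ Icc (0 : ℝ) 1 :=
    ⟨by positivity, pow_le_one₀ (by norm_num) (by norm_num)⟩
  have hBn := hB _ hn1
  have hline : ContDiff ℝ ∞ fun s : ℝ => f (y n + s • v) :=
    hf _ (contDiff_const.add (contDiff_id.smul contDiff_const))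
  have heq : (f ∘ c) =ᶠ[𝓝 ((2 : ℝ)⁻¹ ^ n)] fun t =>
      (fun s => (fun r : ℝ => f (y n + r • v)) ((1 / n.factorial : ℝ) * s)) (t - (2 : ℝ)⁻¹ ^ n) := by
    filter_upwards [hcn n] with t ht
    simp only [Function.comp_apply, ht]
    rw [mul_comm]
  rw [heq.iteratedDeriv_eq, iteratedDeriv_comp_sub_const k (fun s => (fun r : ℝ => f (y n + r • v))
    ((1 / n.factorial : ℝ) * s)),
    iteratedDeriv_comp_const_mul (hline.of_le (by exact_mod_cast le_top))] at hBn
  simp only [sub_self, mul_zero] at hBn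
  rw [norm_mul, Real.norm_of_nonneg (by positivity), Real.norm_eq_abs] at hBn
  have hfac : (0 : ℝ) < (n.factorial : ℝ) ^ k := by positivity
  have : (n : ℝ) < (1 / (n.factorial : ℝ)) ^ k *
      |iteratedDeriv k (fun s : ℝ => f (y n + s • v)) 0| := by
    rw [one_div, inv_pow, ← div_eq_inv_mul, lt_div_iff₀ hfac]
    exact hyk n
  linarith

end SpecialCurve

/-! ### Continuous differentiability along smooth curves -/

section DirectionalDerivatives

variable {V : Type*} [NormedAddCommGroup V] [NormedSpace ℝ V]

theorem hasDerivAt_line {f : V → ℝ} (hf : ∀ x v, LineDifferentiableAt ℝ f x v) (x v : V) (s : ℝ) :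
    HasDerivAt (fun r : ℝ => f (x + r • v)) (lineDeriv ℝ f (x + s • v) v) s := by
  have h : HasDerivAt (fun r : ℝ => f (x + s • v + r • v)) (lineDeriv ℝ f (x + s • v) v) (s - s) := by
    rw [sub_self]
    exact (hf (x + s • v) v).hasLineDerivAt
  have := h.comp_sub_const s s
  refine this.congr_of_eventuallyEq (Eventually.of_forall fun r => ?_)
  simp only [add_assoc, ← add_smul, add_sub_cancel]

/-- On the plane spanned by `v` and `w` the function has continuous partial derivatives, hence is
differentiable there; the chain rule along the diagonal gives additivity. -/
theorem lineDeriv_add_of_continuous {f : V → ℝ} (hf : ∀ x v, LineDifferentiableAt ℝ f x v)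
    (hc : ∀ v, Continuous fun x => lineDeriv ℝ f x v) (x v w : V) :
    lineDeriv ℝ f x (v + w) = lineDeriv ℝ f x v + lineDeriv ℝ f x w := by
  let D (v : V) (a b : ℝ) : ℝ →L[ℝ] ℝ :=
    ContinuousLinearMap.toSpanSingleton ℝ (lineDeriv ℝ f (x + a • v + b • w) v)
  let D' (a b : ℝ) : ℝ →L[ℝ] ℝ :=
    ContinuousLinearMap.toSpanSingleton ℝ (lineDeriv ℝ f (x + a • v + b • w) w)
  have hcont : Continuous fun p : ℝ × ℝ => x + p.1 • v + p.2 • w := by fun_prop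
  have hspan : Continuous fun a : ℝ => ContinuousLinearMap.toSpanSingleton ℝ a :=
    (ContinuousLinearMap.toSpanSingletonCLE (𝕜 := ℝ) (E := ℝ)).continuous
  have hstrict := hasStrictFDerivAt_uncurry_coprod (𝕜 := ℝ) (u := ((0 : ℝ), (0 : ℝ)))
    (f := fun a b : ℝ => f (x + a • v + b • w)) (f₁ := D v) (f₂ := D')
    (Eventually.of_forall fun p => by
      have := hasDerivAt_line hf (x + p.2 • w) v p.1
      simp only [add_right_comm x (p.2 • w)] at this
      exact this.hasFDerivAt)
    (Eventually.of_forall fun p => (hasDerivAt_line hf (x + p.1 • v) w p.2).hasFDerivAt)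
    (hspan.comp ((hc v).comp hcont)).continuousAt (hspan.comp ((hc w).comp hcont)).continuousAt
  have hdiag : HasDerivAt (fun t : ℝ => (t, t)) ((1 : ℝ), (1 : ℝ)) 0 :=
    (hasDerivAt_id 0).prodMk (hasDerivAt_id 0)
  have h := HasFDerivAt.comp_hasDerivAt (f := fun t : ℝ => (t, t)) 0 hstrict.hasFDerivAt hdiag
  have h' := hasDerivAt_line hf x (v + w) 0
  have heq : (fun r : ℝ => f (x + r • (v + w))) =
      (Function.uncurry fun a b : ℝ => f (x + a • v + b • w)) ∘ fun t : ℝ => (t, t) := by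
    funext r
    simp [add_assoc]
  rw [heq] at h'
  have := h'.unique h
  simpa [D, D', Function.HasUncurry.uncurry] using this

/-- Line derivatives are now linear in the direction, and in finite dimension continuity in each
direction is continuity in operator norm. The mean value inequality on segments turns them into
Fréchet derivatives. -/
theorem contDiff_one_of_continuous_lineDeriv [FiniteDimensional ℝ V] {f : V → ℝ}
    (hf : ∀ x v, LineDifferentiableAt ℝ f x v)
    (hc : ∀ v, Continuous fun x => lineDeriv ℝ f x v) : ContDiff ℝ 1 f := by
  let D : V → V →L[ℝ] ℝ := fun x => LinearMap.toContinuousLinearMap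
    { toFun := lineDeriv ℝ f x
      map_add' := lineDeriv_add_of_continuous hf hc x
      map_smul' := fun r v => lineDeriv_smul }
  have hD : Continuous D := continuous_clm_apply.2 hc
  refine contDiff_one_iff_hasFDerivAt.2 ⟨D, hD, fun x => ?_⟩
  rw [hasFDerivAt_iff_isLittleO_nhds_zero, Asymptotics.isLittleO_iff]
  intro ε hε
  obtain ⟨δ, hδ, hδε⟩ := Metric.continuousAt_iff.1 hD.continuousAt ε hε
  filter_upwards [Metric.ball_mem_nhds (0 : V) hδ] with h hh
  rw [mem_ball_zero_iff] at hh
  have hder : ∀ s ∈ Icc (0 : ℝ) 1, HasDerivWithinAt (fun r : ℝ => f (x + r • h) - r * D x h)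
      (lineDeriv ℝ f (x + s • h) h - 1 * D x h) (Icc 0 1) s := fun s _ =>
    ((hasDerivAt_line hf x h s).sub ((hasDerivAt_id s).mul_const (D x h))).hasDerivWithinAt
  have hbound : ∀ s ∈ Ico (0 : ℝ) 1, ‖lineDeriv ℝ f (x + s • h) h - 1 * D x h‖ ≤ ε * ‖h‖ := by
    intro s hs
    have : dist (x + s • h) x < δ := by
      rw [dist_eq_norm, add_sub_cancel_left, norm_smul, Real.norm_of_nonneg hs.1]
      exact (mul_le_of_le_one_left (norm_nonneg _) hs.2.le).trans_lt hh
    rw [one_mul]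
    exact ((D (x + s • h) - D x).le_opNorm h).trans
      (by gcongr; rw [← dist_eq_norm]; exact (hδε this).le)
  have := norm_image_sub_le_of_norm_deriv_le_segment_01' hder hbound
  simp only [one_smul, one_mul, zero_smul, add_zero, zero_mul, sub_zero] at this
  rwa [sub_right_comm]

end DirectionalDerivatives

/-! ### First-order Boman theorem -/

section Boman

variable {V : Type*} [NormedAddCommGroup V] [NormedSpace ℝ V]

theorem continuous_of_contDiff_comp_curve [CompleteSpace V] {f : V → ℝ}
    (hf : ∀ c : ℝ → V, ContDiff ℝ ∞ c → ContDiff ℝ ∞ (f ∘ c)) : Continuous f :=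
  continuous_def.2 fun _ hU => isOpen_of_contDiff_preimage fun c hc =>
    hU.preimage (hf c hc).continuous

/-- The difference quotients with a fixed step `s` are continuous in the base point. A local bound
`B` on second derivatives puts them within `B * s` of the line derivative, so the latter is a
locally uniform limit of continuous functions. -/
theorem continuous_lineDeriv_of_contDiff_comp_curve [CompleteSpace V] {f : V → ℝ}
    (hf : ∀ c : ℝ → V, ContDiff ℝ ∞ c → ContDiff ℝ ∞ (f ∘ c)) (v : V) :
    Continuous fun x => lineDeriv ℝ f x v := by
  have hline : ∀ y, ContDiff ℝ ∞ fun s : ℝ => f (y + s • v) := fun y =>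
    hf _ (contDiff_const.add (contDiff_id.smul contDiff_const))
  have hfc := continuous_of_contDiff_comp_curve hf
  refine continuous_iff_continuousAt.2 fun x => ?_
  obtain ⟨B, hB⟩ := exists_eventually_abs_iteratedDeriv_le hf 2 v x
  have hB0 : 0 ≤ B := (abs_nonneg _).trans hB.self_of_nhds
  have hlim : Tendsto (fun p : V × ℝ => p.1 + p.2 • v) (𝓝 x ×ˢ 𝓝 0) (𝓝 x) := by
    rw [← nhds_prod_eq]
    exact (by fun_prop : Continuous fun p : V × ℝ => p.1 + p.2 • v).tendsto' _ _ (by simp)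
  obtain ⟨t, ht, b, hb, htb⟩ := eventually_prod_iff.1 (hlim.eventually hB)
  obtain ⟨δ, hδ, hδb⟩ := Metric.eventually_nhds_iff.1 hb
  refine continuousAt_of_locally_uniform_approx_of_continuousAt fun u hu => ?_
  obtain ⟨ε, hε, hεu⟩ := Metric.mem_uniformity_dist.1 hu
  obtain ⟨s, hs0, hsδ, hsε⟩ : ∃ s : ℝ, 0 < s ∧ s < δ ∧ B * s < ε := by
    refine ⟨min (δ / 2) (ε / (B + 1) / 2), by positivity,
      (min_le_left _ _).trans_lt (by linarith), ?_⟩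
    calc B * min (δ / 2) (ε / (B + 1) / 2) ≤ (B + 1) * (ε / (B + 1) / 2) :=
          mul_le_mul (by linarith) (min_le_right _ _) (by positivity) (by linarith)
      _ = ε / 2 := by field_simp
      _ < ε := by linarith
  refine ⟨{y | t y}, ht, fun y => (f (y + s • v) - f y) / s, by fun_prop, fun y hy => hεu ?_⟩
  let φ : ℝ → ℝ := fun r => f (y + r • v)
  have hφ : ContDiff ℝ ∞ φ := hline y
  have hφ1 : ContDiff ℝ ∞ (deriv φ) := (contDiff_infty_iff_deriv.1 hφ).2
  have hφ' : ∀ r, HasDerivAt φ (deriv φ r) r := fun r =>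
    ((contDiff_infty_iff_deriv.1 hφ).1 r).hasDerivAt
  have hφ'' : ∀ r, HasDerivAt (deriv φ) (deriv (deriv φ) r) r := fun r =>
    ((contDiff_infty_iff_deriv.1 hφ1).1 r).hasDerivAt
  have hsecond : ∀ r ∈ Icc 0 s, ‖deriv (deriv φ) r‖ ≤ B := fun r hr => by
    have h1 := htb hy (hδb (y := r) (by
      rw [Real.dist_0_eq_abs, abs_of_nonneg hr.1]; exact hr.2.trans_lt hsδ))
    have h2 : (fun a : ℝ => f (y + r • v + a • v)) = fun a => φ (a + r) := by
      funext a
      simp only [φ, add_smul]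
      rw [add_right_comm, add_assoc]
    rw [h2, iteratedDeriv_comp_add_const] at h1
    simpa [iteratedDeriv_succ, iteratedDeriv_one] using h1
  have hfirst : ∀ r ∈ Icc 0 s, ‖deriv φ r - deriv φ 0‖ ≤ B * s := fun r hr => by
    have := (convex_Icc (0 : ℝ) s).norm_image_sub_le_of_norm_hasDerivWithin_le
      (fun r _ => (hφ'' r).hasDerivWithinAt) hsecond (left_mem_Icc.2 hs0.le) hr
    refine this.trans ?_
    rw [sub_zero, Real.norm_of_nonneg hr.1]
    exact mul_le_mul_of_nonneg_left hr.2 hB0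
  have hzero : ‖(φ s - s * deriv φ 0) - (φ 0 - 0 * deriv φ 0)‖ ≤ B * s * ‖s - 0‖ :=
    (convex_Icc (0 : ℝ) s).norm_image_sub_le_of_norm_hasDerivWithin_le
      (f := fun r => φ r - r * deriv φ 0)
      (fun r _ => ((hφ' r).sub ((hasDerivAt_id r).mul_const (deriv φ 0))).hasDerivWithinAt)
      (fun r hr => by simpa using hfirst r hr) (left_mem_Icc.2 hs0.le) (right_mem_Icc.2 hs0.le)
  have hφ0 : φ 0 = f y := by simp [φ]
  rw [zero_mul, sub_zero, sub_zero, Real.norm_of_nonneg hs0.le, hφ0] at hzero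
  have hd : lineDeriv ℝ f y v - (f (y + s • v) - f y) / s =
      -((φ s - s * deriv φ 0 - f y) / s) := by
    simp only [lineDeriv, φ]
    field_simp
    ring
  rw [Real.dist_eq, hd, abs_neg, abs_div, abs_of_pos hs0, div_lt_iff₀ hs0]
  calc |φ s - s * deriv φ 0 - f y| ≤ B * s * s := hzero
    _ < ε * s := by gcongr

/-- A function on a finite-dimensional space that is smooth along smooth curves is continuously
differentiable (the first order part of Boman's theorem). -/
theorem contDiff_one_of_contDiff_comp_curve [FiniteDimensional ℝ V] {f : V → ℝ}
    (hf : ∀ c : ℝ → V, ContDiff ℝ ∞ c → ContDiff ℝ ∞ (f ∘ c)) : ContDiff ℝ 1 f := by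
  have : CompleteSpace V := FiniteDimensional.complete ℝ V
  refine contDiff_one_of_continuous_lineDeriv (fun x v => ?_)
    (continuous_lineDeriv_of_contDiff_comp_curve hf)
  have h : ContDiff ℝ ∞ fun s : ℝ => f (x + s • v) :=
    hf _ (contDiff_const.add (contDiff_id.smul contDiff_const))
  exact (h.differentiable (by simp)).differentiableAt

end Boman

/-! ### Smooth curves in manifolds -/

namespace CInftyManifold

/-- A curve in a manifold is smooth if it is smooth in charts. -/
def IsSmoothCurve (M : CInftyManifold.{u, v, w}) (c : ℝ → M) : Prop :=
  ∀ t j, c t ∈ (M.chart j).source →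
    ∃ b : ℝ → M.E j, SmoothCurve b ∧
      ∀ᶠ s in 𝓝 t, c s ∈ (M.chart j).source ∧ M.chart j (c s) = b s

variable {M : CInftyManifold.{u, v, w}} {N : CInftyManifold.{u', v', w'}}

theorem isSmoothCurve_const (x : M) : M.IsSmoothCurve fun _ => x := fun _ j hx =>
  ⟨fun _ => M.chart j x, smoothCurve_const _, Eventually.of_forall fun _ => ⟨hx, rfl⟩⟩

theorem IsSmoothCurve.comp_contDiff {c : ℝ → M} (hc : M.IsSmoothCurve c) {φ : ℝ → ℝ}
    (hφ : ContDiff ℝ ∞ φ) : M.IsSmoothCurve (c ∘ φ) := fun t j ht => by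
  obtain ⟨b, hb, hcb⟩ := hc (φ t) j ht
  exact ⟨b ∘ φ, hb.comp_contDiff hφ, hφ.continuous.continuousAt.eventually hcb⟩

theorem IsSmoothCurve.smoothCurve_chart {c : ℝ → M} (hc : M.IsSmoothCurve c) {j : M.ι}
    (h : ∀ t, c t ∈ (M.chart j).source) : SmoothCurve (M.chart j ∘ c) :=
  SmoothCurve.of_locally fun t => by
    obtain ⟨b, hb, hcb⟩ := hc t j (h t)
    exact ⟨b, hb, hcb.mono fun s hs => hs.2⟩

theorem isCInftyOpen_chart_source (M : CInftyManifold.{u, v, w}) (i : M.ι) :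
    IsCInftyOpen (M.chart i '' (M.chart i).source) := by
  simpa using M.isCInftyOpen_overlap i i

theorem isSmoothCurve_chart_symm {i : M.ι} {c : ℝ → M.E i} (hc : SmoothCurve c)
    (h : ∀ t, c t ∈ M.chart i '' (M.chart i).source) :
    M.IsSmoothCurve ((M.chart i).symm ∘ c) := fun t j ht => by
  have hsymm : ∀ s, (M.chart i).symm (c s) ∈ (M.chart i).source ∧
      M.chart i ((M.chart i).symm (c s)) = c s := fun s => by
    obtain ⟨x, hx, hxs⟩ := h s
    rw [← hxs, (M.chart i).left_inv hx]
    exact ⟨hx, rfl⟩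
  have hO := M.isCInftyOpen_overlap j i c hc
  -- `CInftySmoothOn` tests only curves lying wholly in the set, so the curve is reparametrized to
  -- stay in the overlap without changing it near `t`.
  obtain ⟨ρ, hρ, hρO, hρt⟩ := exists_contDiff_mapsTo_eventuallyEq_id (x := t)
    (hO.mem_nhds ⟨_, ⟨ht, (hsymm t).1⟩, (hsymm t).2⟩)
  refine ⟨_, M.smooth_change j i (c ∘ ρ) (hc.comp_contDiff hρ) hρO, ?_⟩
  filter_upwards [hρt] with s hs
  have hs' := hρO s
  simp only [hs, id_eq, mem_preimage] at hs'
  obtain ⟨x, ⟨hxj, hxi⟩, hxs⟩ := hs'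
  simp only [Function.comp_apply, hs, id_eq, and_true]
  rwa [← hxs, (M.chart i).left_inv hxi]

theorem Smooth.isSmoothCurve_comp {f : M → N} (hf : Smooth f) {c : ℝ → M}
    (hc : M.IsSmoothCurve c) : N.IsSmoothCurve (f ∘ c) := fun t j ht => by
  obtain ⟨i, W, hcW, hWi, hWo, hfW, hs⟩ := hf (c t) j ht
  obtain ⟨b, hb, hcb⟩ := hc t i (hWi hcW)
  have hbW : ∀ᶠ s in 𝓝 t, b s ∈ M.chart i '' W :=
    (hWo b hb).mem_nhds ⟨c t, hcW, hcb.self_of_nhds.2⟩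
  obtain ⟨ρ, hρ, hρO, hρt⟩ := exists_contDiff_mapsTo_eventuallyEq_id hbW
  refine ⟨_, hs (b ∘ ρ) (hb.comp_contDiff hρ) hρO, ?_⟩
  filter_upwards [hρt, hcb, hbW] with s hs hcs hbs
  obtain ⟨x, hxW, hxs⟩ := hbs
  have hx : x = c s := (M.chart i).injOn (hWi hxW) hcs.1 (hxs.trans hcs.2.symm)
  refine ⟨hfW (hx ▸ hxW), ?_⟩
  simp only [Function.comp_apply, hs, id_eq, ← hcs.2, (M.chart i).left_inv hcs.1]

/-- A map of manifolds is smooth if and only if it maps smooth curves to smooth curves. -/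
theorem smooth_iff_isSmoothCurve {f : M → N} :
    Smooth f ↔ ∀ c, M.IsSmoothCurve c → N.IsSmoothCurve (f ∘ c) := by
  refine ⟨fun hf c hc => hf.isSmoothCurve_comp hc, fun hf x j hx => ?_⟩
  obtain ⟨i, hi⟩ := M.cover x
  -- This largest candidate is `c^∞`-open because the image under `f` of a smooth curve is smooth,
  -- and so stays in the target chart for nearby times.
  refine ⟨i, (M.chart i).source ∩ f ⁻¹' (N.chart j).source, ⟨hi, hx⟩, inter_subset_left, ?_,
    fun y hy => hy.2, ?_⟩
  · intro c hc
    rw [isOpen_iff_mem_nhds]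
    rintro t ⟨y, ⟨hyi, hyj⟩, hyt⟩
    obtain ⟨ρ, hρ, hρO, hρt⟩ := exists_contDiff_mapsTo_eventuallyEq_id (x := t)
      ((M.isCInftyOpen_chart_source i c hc).mem_nhds ⟨y, hyi, hyt⟩)
    have hcur := hf _ (isSmoothCurve_chart_symm (hc.comp_contDiff hρ) hρO)
    have ht : (f ∘ (M.chart i).symm ∘ c ∘ ρ) t ∈ (N.chart j).source := by
      simp only [Function.comp_apply, hρt.self_of_nhds, id_eq, ← hyt, (M.chart i).left_inv hyi]
      exact hyj
    obtain ⟨b, -, hb⟩ := hcur t j ht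
    filter_upwards [hb, hρt] with s hbs hs
    obtain ⟨z, hz, hzs⟩ := hρO s
    simp only [hs, id_eq] at hzs
    have h1 := hbs.1
    simp only [Function.comp_apply, hs, id_eq, ← hzs, (M.chart i).left_inv hz] at h1
    exact ⟨z, ⟨hz, h1⟩, hzs⟩
  · intro c hc hcW
    refine (hf _ (isSmoothCurve_chart_symm hc fun t =>
      image_mono inter_subset_left (hcW t))).smoothCurve_chart fun t => ?_
    obtain ⟨y, ⟨hyi, hyj⟩, hyt⟩ := hcW t
    simp only [Function.comp_apply, ← hyt, (M.chart i).left_inv hyi]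
    exact hyj

theorem isSmoothCurve_euclideanManifold_iff {n : ℕ} {c : ℝ → EuclideanSpace ℝ (Fin n)} :
    (euclideanManifold n).IsSmoothCurve c ↔ ContDiff ℝ ∞ c := by
  rw [← smoothCurve_iff_contDiff]
  refine ⟨fun h => SmoothCurve.of_locally fun t => ?_, fun h t j _ =>
    ⟨c, h, Eventually.of_forall fun s => ⟨mem_univ _, rfl⟩⟩⟩
  obtain ⟨b, hb, hcb⟩ := h t () (mem_univ _)
  exact ⟨b, hb, hcb.mono fun s hs => hs.2⟩

theorem isPlot_iff_isSmoothCurve {n : ℕ} {p : EuclideanSpace ℝ (Fin n) → M} :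
    IsPlot p ↔ ∀ γ : ℝ → EuclideanSpace ℝ (Fin n), ContDiff ℝ ∞ γ → M.IsSmoothCurve (p ∘ γ) :=
  (smooth_iff_isSmoothCurve (M := euclideanManifold n)).trans
    (forall_congr' fun _ => imp_congr isSmoothCurve_euclideanManifold_iff Iff.rfl)

theorem isPlot_comp_coord_iff {c : ℝ → M} :
    IsPlot (fun y : EuclideanSpace ℝ (Fin 1) => c (y 0)) ↔ M.IsSmoothCurve c := by
  rw [isPlot_iff_isSmoothCurve]
  refine ⟨fun h => ?_, fun hc γ hγ => ?_⟩
  · exact h (fun t => WithLp.toLp 2 fun _ => t) (contDiff_euclidean.2 fun _ => contDiff_id)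
  · exact hc.comp_contDiff (φ := fun t => γ t 0) (contDiff_euclidean.1 hγ 0)

/-- Makes the separation axiom, which is stated for continuous curves, available for smooth ones. -/
theorem IsSmoothCurve.continuousCurve {c : ℝ → M} (hc : M.IsSmoothCurve c) :
    M.ContinuousCurve c := fun W hW => by
  rw [isOpen_iff_mem_nhds]
  intro t ht
  obtain ⟨i, hi⟩ := M.cover (c t)
  obtain ⟨b, hb, hcb⟩ := hc t i hi
  have hbW : ∀ᶠ s in 𝓝 t, b s ∈ M.chart i '' (W ∩ (M.chart i).source) :=
    (hW i b hb).mem_nhds ⟨c t, ⟨ht, hi⟩, hcb.self_of_nhds.2⟩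
  filter_upwards [hcb, hbW] with s hs hbs
  obtain ⟨x, ⟨hxW, hxi⟩, hxs⟩ := hbs
  rw [mem_preimage, ← (M.chart i).injOn hxi hs.1 (hxs.trans hs.2.symm)]
  exact hxW

section FiniteDimensional

variable {V : Type*} [NormedAddCommGroup V] [NormedSpace ℝ V] {q : V → M}

theorem isOpen_preimage_chart_source [CompleteSpace V]
    (hq : ∀ γ : ℝ → V, ContDiff ℝ ∞ γ → M.IsSmoothCurve (q ∘ γ)) (j : M.ι) :
    IsOpen (q ⁻¹' (M.chart j).source) :=
  isOpen_of_contDiff_preimage fun γ hγ => isOpen_iff_mem_nhds.2 fun t ht => by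
    obtain ⟨b, -, hb⟩ := hq γ hγ t j ht
    exact hb.mono fun s hs => hs.1

/-- Precomposing with a smooth map into the preimage of the chart domain, equal to the identity near
`y`, gives a function on all of `V` to which Boman's theorem applies. -/
theorem contDiffAt_dual_chart [FiniteDimensional ℝ V]
    (hq : ∀ γ : ℝ → V, ContDiff ℝ ∞ γ → M.IsSmoothCurve (q ∘ γ)) {j : M.ι} {y : V}
    (hy : q y ∈ (M.chart j).source) (ℓ : M.E j →L[ℝ] ℝ) :
    ContDiffAt ℝ 1 (fun z => ℓ (M.chart j (q z))) y := by
  have : CompleteSpace V := FiniteDimensional.complete ℝ V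
  obtain ⟨ρ, hρ, hρO, hρy⟩ := exists_contDiff_mapsTo_eventuallyEq_id
    ((isOpen_preimage_chart_source hq j).mem_nhds hy)
  have h : ContDiff ℝ 1 fun z => ℓ (M.chart j (q (ρ z))) :=
    contDiff_one_of_contDiff_comp_curve fun c hc =>
      ((hq _ (hρ.comp hc)).smoothCurve_chart fun t => hρO (c t)).contDiff_dual ℓ
  refine h.contDiffAt.congr_of_eventuallyEq ?_
  filter_upwards [hρy] with z hz
  rw [hz, id_eq]

end FiniteDimensional

end CInftyManifold

/-! ### Plots of skeleta -/

section Skeleton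

variable {X Y : Type*} [DiffeologicalSpace X] [DiffeologicalSpace Y] {d : ℕ}

/-- Maps that factor locally through plots of dimension at most `d`. -/
def FactorsLocally (d : ℕ) (X : Type*) [DiffeologicalSpace X] {m : ℕ}
    (p : EuclideanSpace ℝ (Fin m) → X) : Prop :=
  ∀ x, ∃ n ≤ d, ∃ (q : EuclideanSpace ℝ (Fin n) → X)
    (h : EuclideanSpace ℝ (Fin m) → EuclideanSpace ℝ (Fin n)),
    IsPlot q ∧ ContDiff ℝ ∞ h ∧ p =ᶠ[𝓝 x] q ∘ h

theorem isPlot_of_eventuallyEq_isPlot {m : ℕ} {p : EuclideanSpace ℝ (Fin m) → X}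
    (h : ∀ x, ∃ q : EuclideanSpace ℝ (Fin m) → X, IsPlot q ∧ p =ᶠ[𝓝 x] q) : IsPlot p := by
  refine DiffeologicalSpace.locality fun x => ?_
  obtain ⟨q, hq, hpq⟩ := h x
  obtain ⟨u, hu, huo, hxu⟩ := eventually_nhds_iff.1 hpq
  refine ⟨u, huo, hxu, fun {k f} hfu hf => ?_⟩
  have : p ∘ f = q ∘ f := funext fun y => hu _ (hfu y)
  rw [this]
  exact isPlot_reparam hq hf

/-- Locally factoring maps form a diffeology containing the generating plots, so they include the
generated one; the converse is locality. -/
theorem isPlot_skeleton_iff {m : ℕ} {p : EuclideanSpace ℝ (Fin m) → Skeleton d X} :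
    IsPlot p ↔ FactorsLocally d X p := by
  constructor
  · intro hp
    let D : DiffeologicalSpace X :=
      { plots := fun m => {p | FactorsLocally d X p}
        constant_plots := fun x _ => ⟨0, zero_le, fun _ => x, fun _ => 0, isPlot_const,
          contDiff_const, EventuallyEq.rfl⟩
        plot_reparam := fun {_ _ p f} hp hf x => by
          obtain ⟨n, hn, q, h, hq, hh, hpq⟩ := hp (f x)
          exact ⟨n, hn, q, h ∘ f, hq, hh.comp hf, hf.continuous.continuousAt.eventually hpq⟩
        locality := fun {k p} hp x => by
          obtain ⟨u, hu, hxu, hpu⟩ := hp x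
          obtain ⟨ρ, hρ, hρu, hρx⟩ := exists_contDiff_mapsTo_eventuallyEq_id (hu.mem_nhds hxu)
          obtain ⟨n, hn, q, h, hq, hh, hpq⟩ := hpu hρu hρ x
          refine ⟨n, hn, q, h, hq, hh, ?_⟩
          filter_upwards [hρx, hpq] with y hy hy'
          rw [← hy', Function.comp_apply, hy, id_eq] }
    refine hp D fun q hq x => ?_
    exact ⟨q.1, hq.1, q.2, id, hq.2, contDiff_id, EventuallyEq.rfl⟩
  · intro hp
    refine isPlot_of_eventuallyEq_isPlot fun x => ?_
    obtain ⟨n, hn, q, h, hq, hh, hpq⟩ := hp x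
    refine ⟨q ∘ h, isPlot_reparam (X := Skeleton d X) ?_ hh, hpq⟩
    exact DiffeologicalSpace.isPlot_generatedFrom_of_mem
      (g := {q : (n : ℕ) × (EuclideanSpace ℝ (Fin n) → X) | q.1 ≤ d ∧ IsPlot q.2}) ⟨hn, hq⟩

theorem Diffeology.IsPlot.of_skeleton {m : ℕ} {p : EuclideanSpace ℝ (Fin m) → Skeleton d X}
    (hp : IsPlot p) : IsPlot (X := X) p :=
  isPlot_of_eventuallyEq_isPlot (X := X) fun x => by
    obtain ⟨n, hn, q, h, hq, hh, hpq⟩ := isPlot_skeleton_iff.1 hp x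
    exact ⟨q ∘ h, isPlot_reparam hq hh, hpq⟩

theorem Diffeology.IsPlot.skeleton {n : ℕ} (hn : n ≤ d) {p : EuclideanSpace ℝ (Fin n) → X}
    (hp : IsPlot p) :
    IsPlot (X := Skeleton d X) p :=
  isPlot_skeleton_iff.2 fun _ => ⟨n, hn, p, id, hp, contDiff_id, EventuallyEq.rfl⟩

theorem Diffeology.DSmooth.skeleton {f : X → Y} (hf : DSmooth f) (d : ℕ) :
    DSmooth (X := Skeleton d X) (Y := Skeleton d Y) f := fun _ p hp =>
  isPlot_skeleton_iff.2 fun x => by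
    obtain ⟨n, hn, q, h, hq, hh, hpq⟩ := isPlot_skeleton_iff.1 hp x
    exact ⟨n, hn, f ∘ q, h, hf _ _ hq, hh, hpq.fun_comp f⟩

end Skeleton

/-! ### Smooth maps of manifolds and of their skeleta -/

namespace CInftyManifold

variable {M : CInftyManifold.{u, v, w}} {N : CInftyManifold.{u', v', w'}} {d : ℕ}

theorem Smooth.dSmooth {f : M → N} (hf : Smooth f) : DSmooth f := fun n _ hp =>
  (smooth_iff_isSmoothCurve (M := euclideanManifold n)).2 fun _ hc =>
    hf.isSmoothCurve_comp (Smooth.isSmoothCurve_comp (M := euclideanManifold n) hp hc)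

/-- As `d ≥ 1`, smooth curves are plots of the skeleton, and plots of the skeleton are plots of the
manifold; so `f` preserves smooth curves. -/
theorem smooth_of_dSmooth_skeleton (hd : 0 < d) {f : M → N}
    (hf : DSmooth (X := Skeleton d M) (Y := Skeleton d N) f) : Smooth f :=
  smooth_iff_isSmoothCurve.2 fun c hc => by
    have h : IsPlot (X := Skeleton d M) fun y : EuclideanSpace ℝ (Fin 1) => c (y 0) :=
      IsPlot.skeleton (X := M) hd (isPlot_comp_coord_iff.2 hc)
    exact isPlot_comp_coord_iff.1 (IsPlot.of_skeleton (X := N) (hf _ _ h))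

theorem diffeomorphic_of_dDiffeomorphic_skeleton (hd : 0 < d)
    (h : DDiffeomorphic (Skeleton d M) (Skeleton d N)) : Diffeomorphic M N := by
  obtain ⟨e, he, he'⟩ := h
  exact ⟨e, smooth_of_dSmooth_skeleton hd he, smooth_of_dSmooth_skeleton hd he'⟩

theorem Diffeomorphic.dDiffeomorphic_skeleton (h : Diffeomorphic M N) (d : ℕ) :
    DDiffeomorphic (Skeleton d M) (Skeleton d N) := by
  obtain ⟨e, he, he'⟩ := h
  exact ⟨e, DSmooth.skeleton he.dSmooth d, DSmooth.skeleton he'.dSmooth d⟩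

end CInftyManifold

theorem DDiffeomorphic.smoothlyHomotopyEquivalent {X Y : Type*} [DiffeologicalSpace X]
    [DiffeologicalSpace Y] (h : DDiffeomorphic X Y) : SmoothlyHomotopyEquivalent X Y := by
  obtain ⟨e, he, he'⟩ := h
  refine ⟨e, e.symm, he, he', ⟨Prod.fst, fun _ _ hp => hp.1, ?_, fun _ => rfl⟩,
    ⟨Prod.fst, fun _ _ hp => hp.1, ?_, fun _ => rfl⟩⟩ <;> simp

/-! ### Linear algebra -/

/-- By `hinj` each given vector can be scaled to `(b k, 1)`, and any two of these agree, their
difference having last coordinate `0`. The common `b` vanishes in every coordinate. -/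
theorem zero_one_mem_of_exists_mem_apply_eq_zero {ι : Type*} [Nonempty ι]
    {K : Submodule ℝ ((ι → ℝ) × ℝ)} (hinj : ∀ a, (a, (0 : ℝ)) ∈ K → a = 0)
    (hK : ∀ k, ∃ w ∈ K, w ≠ 0 ∧ w.1 k = 0) : ((0 : ι → ℝ), (1 : ℝ)) ∈ K := by
  have hnorm : ∀ k, ∃ b : ι → ℝ, (b, (1 : ℝ)) ∈ K ∧ b k = 0 := fun k => by
    obtain ⟨⟨a, α⟩, hw, hw0, hwk⟩ := hK k
    have hα : α ≠ 0 := by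
      rintro rfl
      exact hw0 (by rw [hinj a hw]; rfl)
    refine ⟨α⁻¹ • a, ?_, by simp_all⟩
    have := K.smul_mem α⁻¹ hw
    rwa [Prod.smul_mk, smul_eq_mul, inv_mul_cancel₀ hα] at this
  choose b hb hbk using hnorm
  obtain ⟨k₀⟩ := ‹Nonempty ι›
  have heq : ∀ k, b k = b k₀ := fun k => sub_eq_zero.1 (hinj _ (by
    simpa using K.sub_mem (hb k) (hb k₀)))
  have h0 : b k₀ = 0 := funext fun k => by rw [← heq k, hbk k]; rfl
  exact h0 ▸ hb k₀

/-- Since continuous functionals separate points, each coordinate functional on the span of `v` is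
the restriction of one on `E`. -/
theorem exists_dual_family {E : Type*} [AddCommGroup E] [Module ℝ E] [TopologicalSpace E]
    [SeparatingDual ℝ E] {ι : Type*} [Fintype ι] [DecidableEq ι] {v : ι → E}
    (hv : LinearIndependent ℝ v) :
    ∃ ℓ : ι → E →L[ℝ] ℝ, ∀ i j, ℓ j (v i) = if i = j then 1 else 0 := by
  have hinj : Function.Injective (Fintype.linearCombination ℝ v) :=
    hv.fintypeLinearCombination_injective
  choose ℓ hℓ using fun j => (SeparatingDual.dualMap_surjective_iff (R := ℝ)).2 hinj
    (LinearMap.proj j : (ι → ℝ) →ₗ[ℝ] ℝ)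
  refine ⟨ℓ, fun i j => ?_⟩
  have := LinearMap.congr_fun (hℓ j) (Pi.single i 1)
  simpa [Pi.single_apply, eq_comm] using this

/-! ### Constancy in a direction of rank deficiency -/

/-- If the derivative of `φ` has, at each point of `Ω`, a kernel vector in each of the coordinate
hyperplanes, and is nondegenerate in the first variable at `(0, t₀)`, then `φ` does not depend on
the second variable near `(0, t₀)`. -/
theorem exists_ball_eq_of_fderiv_kernel {ι : Type*} [Fintype ι] [Nonempty ι]
    [DecidableEq ι] {E : Type*}
    [AddCommGroup E] [Module ℝ E] [TopologicalSpace E] [SeparatingDual ℝ E]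
    {φ : (ι → ℝ) × ℝ → E} {Ω : Set ((ι → ℝ) × ℝ)} {t₀ : ℝ} (hΩ : Ω ∈ 𝓝 (0, t₀))
    (hdiff : ∀ z ∈ Ω, ∀ ℓ : E →L[ℝ] ℝ, ContDiffAt ℝ 1 (fun y => ℓ (φ y)) z)
    (hker : ∀ z ∈ Ω, ∀ k, ∃ w : (ι → ℝ) × ℝ, w ≠ 0 ∧ w.1 k = 0 ∧
      ∀ ℓ : E →L[ℝ] ℝ, fderiv ℝ (fun y => ℓ (φ y)) z w = 0)
    {ℓ : ι → E →L[ℝ] ℝ}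
    (hℓ : ∀ i j, fderiv ℝ (fun y => ℓ j (φ y)) (0, t₀) (Pi.single i 1, 0) = if i = j then 1 else 0) :
    ∃ ε > 0, ∀ u ∈ Metric.ball (0 : ι → ℝ) ε, ∀ τ ∈ Metric.ball t₀ ε, (u, τ) ∈ Ω ∧
      ∀ τ' ∈ Metric.ball t₀ ε, φ (u, τ) = φ (u, τ') := by
  let A : (ι → ℝ) × ℝ → Matrix ι ι ℝ := fun z =>
    Matrix.of fun i j => fderiv ℝ (fun y => ℓ j (φ y)) z (Pi.single i 1, 0)
  have hA : ContinuousAt A (0, t₀) := by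
    refine continuousAt_pi.2 fun i => continuousAt_pi.2 fun j => ?_
    have h1 : ContinuousAt (fderiv ℝ (fun y => ℓ j (φ y))) (0, t₀) :=
      (hdiff _ (mem_of_mem_nhds hΩ) (ℓ j)).continuousAt_fderiv (by simp)
    exact h1.clm_apply continuousAt_const
  have hA1 : A (0, t₀) = 1 := by
    ext i j
    rw [Matrix.one_apply]
    exact hℓ i j
  have hdet : ∀ᶠ z in 𝓝 (0, t₀), (A z).det ≠ 0 := by
    have hc : ContinuousAt (fun z => (A z).det) (0, t₀) :=
      (continuous_id.matrix_det).continuousAt.comp hA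
    exact hc.eventually_ne (by rw [hA1, Matrix.det_one]; exact one_ne_zero)
  have hev : ∀ᶠ z in 𝓝 ((0 : ι → ℝ), t₀), z ∈ Ω ∧
      ∀ ℓ : E →L[ℝ] ℝ, fderiv ℝ (fun y => ℓ (φ y)) z (0, 1) = 0 := by
    filter_upwards [hdet, hΩ] with z hz hzΩ
    refine ⟨hzΩ, ?_⟩
    -- `K` plays the role of the kernel of the derivative of `φ`, which is only known to exist after
    -- applying functionals.
    let K : Submodule ℝ ((ι → ℝ) × ℝ) :=
      ⨅ ℓ : E →L[ℝ] ℝ, LinearMap.ker (fderiv ℝ (fun y => ℓ (φ y)) z).toLinearMap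
    have hmem : ∀ w, w ∈ K ↔ ∀ ℓ : E →L[ℝ] ℝ, fderiv ℝ (fun y => ℓ (φ y)) z w = 0 := fun w => by
      simp [K, Submodule.mem_iInf]
    refine (hmem _).1 (zero_one_mem_of_exists_mem_apply_eq_zero (fun a ha => ?_) fun k => ?_)
    -- Invertibility of the Jacobian `A z` in the first variable says that `K` contains no nonzero
    -- `(a, 0)`.
    · refine Matrix.eq_zero_of_vecMul_eq_zero hz (funext fun j => ?_)
      have h1 := (hmem _).1 ha (ℓ j)
      have h2 : (a, (0 : ℝ)) = ∑ i, a i • ((Pi.single i 1 : ι → ℝ), (0 : ℝ)) := by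
        refine Prod.ext ?_ ?_
        · simp only [Prod.fst_sum, Prod.smul_fst]
          exact pi_eq_sum_univ' a
        · simp [Prod.snd_sum]
      rw [h2, map_sum] at h1
      simp only [map_smul, smul_eq_mul] at h1
      exact h1
    · obtain ⟨w, hw0, hwk, hw⟩ := hker z hzΩ k
      exact ⟨w, (hmem w).2 hw, hw0, hwk⟩
  obtain ⟨ε, hε, hball⟩ := Metric.eventually_nhds_iff_ball.1 hev
  have hbox : ∀ u ∈ Metric.ball (0 : ι → ℝ) ε, ∀ τ ∈ Metric.ball t₀ ε,
      (u, τ) ∈ Metric.ball ((0 : ι → ℝ), t₀) ε := fun u hu τ hτ => by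
    rw [← ball_prod_same]
    exact ⟨hu, hτ⟩
  refine ⟨ε, hε, fun u hu τ hτ => ⟨(hball _ (hbox u hu τ hτ)).1, fun τ' hτ' => ?_⟩⟩
  refine (SeparatingDual.eq_iff_forall_dual_eq (R := ℝ)).2 fun ℓ => ?_
  have hder : ∀ s ∈ Metric.ball t₀ ε, HasDerivAt (fun s => ℓ (φ (u, s))) 0 s := fun s hs => by
    obtain ⟨hsΩ, hs0⟩ := hball _ (hbox u hu s hs)
    have h1 := ((hdiff _ hsΩ ℓ).differentiableAt one_ne_zero).hasFDerivAt
    have h2 : HasDerivAt (fun s : ℝ => (u, s)) ((0 : ι → ℝ), (1 : ℝ)) s :=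
      (hasDerivAt_const s u).prodMk (hasDerivAt_id s)
    have h3 := HasFDerivAt.comp_hasDerivAt (f := fun s : ℝ => (u, s)) s h1 h2
    rwa [hs0 ℓ] at h3
  exact Metric.isOpen_ball.is_const_of_deriv_eq_zero (f := fun s => ℓ (φ (u, s)))
    (convex_ball t₀ ε).isPreconnected
    (fun s hs => (hder s hs).differentiableAt.differentiableWithinAt)
    (fun s hs => (hder s hs).deriv) hτ hτ'

/-! ### Rigidity of homotopies of skeleta -/

namespace CInftyManifold

variable {M : CInftyManifold.{u, v, w}} {d : ℕ}

/-- The derivative of a plot of the `d`-skeleton of dimension greater than `d` has a kernel. -/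
theorem exists_ne_zero_fderiv_plot_skeleton_eq_zero {m : ℕ} (hdm : d < m)
    {p : EuclideanSpace ℝ (Fin m) → M} (hp : IsPlot (X := Skeleton d M) p) {j : M.ι}
    {y : EuclideanSpace ℝ (Fin m)} (hy : p y ∈ (M.chart j).source) :
    ∃ a ≠ 0, ∀ ℓ : M.E j →L[ℝ] ℝ, fderiv ℝ (fun z => ℓ (M.chart j (p z))) y a = 0 := by
  obtain ⟨n, hn, q, h, hq, hh, hpq⟩ := isPlot_skeleton_iff (X := M).1 hp y
  have hker := LinearMap.ker_ne_bot_of_finrank_lt (f := (fderiv ℝ h y).toLinearMap)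
    (by simpa using hn.trans_lt hdm)
  obtain ⟨a, ha, ha0⟩ := (Submodule.ne_bot_iff _).1 hker
  refine ⟨a, ha0, fun ℓ => ?_⟩
  have hqy : q (h y) ∈ (M.chart j).source := by
    have := hpq.self_of_nhds
    rw [this] at hy
    exact hy
  have h1 := ((contDiffAt_dual_chart (isPlot_iff_isSmoothCurve.1 hq) hqy ℓ).differentiableAt
    one_ne_zero).hasFDerivAt
  have h2 := (hh.differentiable (by simp) y).hasFDerivAt
  have h3 := (h1.comp y h2).congr_of_eventuallyEq (f₁ := fun z => ℓ (M.chart j (p z))) (by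
    filter_upwards [hpq] with z hz
    rw [hz]
    rfl)
  rw [h3.fderiv, ContinuousLinearMap.comp_apply]
  have : fderiv ℝ h y a = 0 := ha
  rw [this, map_zero]

section Homotopy

variable {F : Skeleton d M × ℝ → Skeleton d M} (hF : DSmooth F)
  {P : (Fin (d + 1) → ℝ) → M}
  (hP : ∀ γ : ℝ → Fin (d + 1) → ℝ, ContDiff ℝ ∞ γ → M.IsSmoothCurve (P ∘ γ))

include hF hP

/-- Along a curve only one-dimensional plots enter, and these survive in the skeleton, although `P`
itself need not be a plot of it. -/
theorem isSmoothCurve_homotopy_comp (hd : 0 < d) {γ : ℝ → (Fin (d + 1) → ℝ) × ℝ}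
    (hγ : ContDiff ℝ ∞ γ) : M.IsSmoothCurve fun t => F (P (γ t).1, (γ t).2) := by
  have h1 : IsPlot (X := Skeleton d M) fun y : EuclideanSpace ℝ (Fin 1) => P (γ (y 0)).1 :=
    IsPlot.skeleton (X := M) hd (isPlot_comp_coord_iff.2 (hP _ (contDiff_fst.comp hγ)))
  have h2 : IsPlot fun y : EuclideanSpace ℝ (Fin 1) => (γ (y 0)).2 :=
    (contDiff_snd.comp (hγ.comp (contDiff_euclidean.1 contDiff_id 0))).isPlot
  have h3 := hF 1 (fun y => (P (γ (y 0)).1, (γ (y 0)).2)) ⟨h1, h2⟩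
  exact isPlot_comp_coord_iff.1 (IsPlot.of_skeleton (X := M) h3)

/-- With its `k`-th coordinate frozen, `P` depends on `d` variables and is a plot of the skeleton.
The unused coordinate `y k` serves as the time of the homotopy. -/
theorem isPlot_skeleton_homotopy_slice (k : Fin (d + 1)) (c : ℝ) :
    IsPlot (X := Skeleton d M) fun y : EuclideanSpace ℝ (Fin (d + 1)) =>
      F (P (Function.update (fun i => y i) k c), y k) := by
  let q : EuclideanSpace ℝ (Fin d) → M := fun y => P (k.insertNth c fun i => y i)
  have hq : IsPlot q := isPlot_iff_isSmoothCurve.2 fun γ hγ => by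
    refine hP (fun t => k.insertNth c fun i => γ t i) (contDiff_pi.2 fun i => ?_)
    refine Fin.succAboveCases k ?_ (fun i => ?_) i
    · simpa using contDiff_const
    · simpa using contDiff_euclidean.1 hγ i
  let h : EuclideanSpace ℝ (Fin (d + 1)) → EuclideanSpace ℝ (Fin d) := fun y =>
    WithLp.toLp 2 fun i => y (k.succAbove i)
  have hh : ContDiff ℝ ∞ h := contDiff_euclidean.2 fun i =>
    contDiff_euclidean.1 contDiff_id (k.succAbove i)
  have h1 : IsPlot (X := Skeleton d M) fun y : EuclideanSpace ℝ (Fin (d + 1)) =>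
      P (Function.update (fun i => y i) k c) := by
    have := isPlot_reparam (X := Skeleton d M) (IsPlot.skeleton (X := M) le_rfl hq) hh
    refine cast (congrArg _ (funext fun y => ?_)) this
    exact congrArg P (Fin.insertNth_removeNth k c fun i => y i)
  have h2 : IsPlot fun y : EuclideanSpace ℝ (Fin (d + 1)) => y k :=
    (contDiff_euclidean.1 contDiff_id k).isPlot
  exact hF _ (fun y => (P (Function.update (fun i => y i) k c), y k)) ⟨h1, h2⟩

theorem exists_fderiv_homotopy_eq_zero (hd : 0 < d) {j : M.ι} {z : (Fin (d + 1) → ℝ) × ℝ}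
    (hz : F (P z.1, z.2) ∈ (M.chart j).source) (k : Fin (d + 1)) :
    ∃ w : (Fin (d + 1) → ℝ) × ℝ, w ≠ 0 ∧ w.1 k = 0 ∧ ∀ ℓ : M.E j →L[ℝ] ℝ,
      fderiv ℝ (fun y : (Fin (d + 1) → ℝ) × ℝ => ℓ (M.chart j (F (P y.1, y.2)))) z w = 0 := by
  -- `L` is the injective linear part of the slice parametrization `σ` through `z`; its image lies
  -- in the hyperplane where the `k`-th coordinate vanishes, so it carries a kernel vector of the
  -- slice to the required `w`.
  let L : EuclideanSpace ℝ (Fin (d + 1)) →L[ℝ] (Fin (d + 1) → ℝ) × ℝ :=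
    (ContinuousLinearMap.pi fun i => if i = k then 0 else EuclideanSpace.proj i).prod
      (EuclideanSpace.proj k)
  let σ : EuclideanSpace ℝ (Fin (d + 1)) → (Fin (d + 1) → ℝ) × ℝ := fun y =>
    L y + (Pi.single k (z.1 k), 0)
  have hσ : ∀ y, σ y = (Function.update (fun i => y i) k (z.1 k), y k) := fun y => by
    refine Prod.ext (funext fun i => ?_) (by simp [σ, L])
    by_cases hi : i = k
    · subst hi; simp [σ, L]
    · simp [σ, L, hi]
  let y₀ : EuclideanSpace ℝ (Fin (d + 1)) := WithLp.toLp 2 (Function.update z.1 k z.2)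
  have hy₀ : σ y₀ = z := by
    rw [hσ]
    refine Prod.ext ?_ (by simp [y₀])
    simp [y₀]
  have hplot := isPlot_skeleton_homotopy_slice hF hP k (z.1 k)
  have hplot' : IsPlot (X := Skeleton d M) fun y => F (P (σ y).1, (σ y).2) := by
    simpa only [hσ] using hplot
  obtain ⟨a, ha, haker⟩ := exists_ne_zero_fderiv_plot_skeleton_eq_zero (lt_add_one d) hplot'
    (y := y₀) (j := j) (by rw [hy₀]; exact hz)
  refine ⟨L a, fun h0 => ha ?_, by simp [L], fun ℓ => ?_⟩
  · ext i
    by_cases hi : i = k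
    · subst hi
      simpa [L] using congrArg Prod.snd h0
    · simpa [L, hi] using congrFun (congrArg Prod.fst h0) i
  · have h1 : HasFDerivAt (fun y : (Fin (d + 1) → ℝ) × ℝ => ℓ (M.chart j (F (P y.1, y.2)))) _ (σ y₀) :=
      ((contDiffAt_dual_chart (q := fun y : (Fin (d + 1) → ℝ) × ℝ => F (P y.1, y.2))
        (fun γ hγ => isSmoothCurve_homotopy_comp hF hP hd hγ)
        (by rw [hy₀]; exact hz) ℓ).differentiableAt one_ne_zero).hasFDerivAt
    have h2 : HasFDerivAt σ L y₀ := L.hasFDerivAt.add_const _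
    have h3 := (h1.comp y₀ h2).fderiv
    have h4 := haker ℓ
    rw [← hy₀, ← ContinuousLinearMap.comp_apply, ← h3]
    exact h4

end Homotopy

theorem exists_linearIndependent_of_lt_dim (hd : (d : ℕ∞) < M.dim) {i : M.ι}
    (hi : (M.chart i).source.Nonempty) :
    ∃ v : Fin (d + 1) → M.E i, LinearIndependent ℝ v := by
  have h : (d : ℕ∞) < Cardinal.toENat (Module.rank ℝ (M.E i)) := hd.trans_le (iInf₂_le i hi)
  refine exists_linearIndependent_of_le_rank ?_
  rw [← Cardinal.natCast_le_toENat]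
  push_cast
  exact Order.add_one_le_of_lt h

/-- A smooth homotopy of the `d`-skeleton of a manifold of dimension greater than `d > 0` that ends
at the identity is constant. -/
theorem homotopy_skeleton_eq_of_eq_id (hd₀ : 0 < d) (hd : (d : ℕ∞) < M.dim)
    {F : Skeleton d M × ℝ → Skeleton d M} (hF : DSmooth F) (hF1 : ∀ x, F (x, 1) = x) (x : M)
    (t : ℝ) : F (x, t) = x := by
  obtain ⟨i, hi⟩ := M.cover x
  obtain ⟨v, hv⟩ := exists_linearIndependent_of_lt_dim hd ⟨x, hi⟩
  obtain ⟨ℓ, hℓ⟩ := exists_dual_family hv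
  let L : (Fin (d + 1) → ℝ) →L[ℝ] M.E i :=
    LinearMap.toContinuousLinearMap (Fintype.linearCombination ℝ v)
  have hLcurve : ∀ γ : ℝ → Fin (d + 1) → ℝ, ContDiff ℝ ∞ γ →
      SmoothCurve fun s => M.chart i x + L (γ s) := fun γ hγ =>
    (smoothCurve_const _).add (((smoothCurve_iff_contDiff γ).2 hγ).continuousLinearMap_comp L)
  have hopen : IsOpen {u | M.chart i x + L u ∈ M.chart i '' (M.chart i).source} :=
    isOpen_of_contDiff_preimage fun γ hγ => M.isCInftyOpen_chart_source i _ (hLcurve γ hγ)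
  obtain ⟨ρ, hρ, hρO, hρ0⟩ := exists_contDiff_mapsTo_eventuallyEq_id (x := 0)
    (hopen.mem_nhds ⟨x, hi, by simp⟩)
  let P : (Fin (d + 1) → ℝ) → M := fun u => (M.chart i).symm (M.chart i x + L (ρ u))
  have hP : ∀ γ : ℝ → Fin (d + 1) → ℝ, ContDiff ℝ ∞ γ → M.IsSmoothCurve (P ∘ γ) := fun γ hγ =>
    isSmoothCurve_chart_symm (hLcurve _ (hρ.comp hγ)) fun s => hρO (γ s)
  have hP0 : P 0 = x := by simp [P, hρ0.self_of_nhds, (M.chart i).left_inv hi]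
  have hPchart : ∀ᶠ u in 𝓝 0, M.chart i (P u) = M.chart i x + L u := by
    filter_upwards [hρ0] with u hu
    obtain ⟨y, hy, hyu⟩ := hρO u
    simp only [P, ← hyu, (M.chart i).left_inv hy]
    rw [hyu, hu, id_eq]
  let G : (Fin (d + 1) → ℝ) × ℝ → M := fun z => F (P z.1, z.2)
  have hG : ∀ γ : ℝ → (Fin (d + 1) → ℝ) × ℝ, ContDiff ℝ ∞ γ → M.IsSmoothCurve (G ∘ γ) :=
    fun γ hγ => isSmoothCurve_homotopy_comp hF hP hd₀ hγ
  -- Equality of germs, not just of values at `0`, is required: it fixes the `u`-derivative of `G`,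
  -- which supplies the nondegeneracy.
  let S : Set ℝ := {τ | ∀ᶠ u in 𝓝 0, G (u, τ) = P u}
  have hdiff : ∀ z ∈ G ⁻¹' (M.chart i).source, ∀ ℓ : M.E i →L[ℝ] ℝ,
      ContDiffAt ℝ 1 (fun y => ℓ (M.chart i (G y))) z := fun z hz ℓ =>
    contDiffAt_dual_chart hG hz ℓ
  have hS0 : ∀ τ ∈ closure S, G (0, τ) = x := fun τ hτ => by
    -- Separation makes the times with `G (0, τ) = x` closed, so at limit times of `S` the point is
    -- still `x` and the chart `i` still applies.
    have hclosed := M.separated _ _ (hG (fun τ => (0, τ))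
      (contDiff_const.prodMk contDiff_id)).continuousCurve (isSmoothCurve_const x).continuousCurve
    exact closure_minimal (fun s hs => hs.self_of_nhds.trans hP0) hclosed hτ
  have hmemΩ : ∀ τ ∈ closure S, ((0 : Fin (d + 1) → ℝ), τ) ∈ G ⁻¹' (M.chart i).source :=
    fun τ hτ => by rw [mem_preimage, hS0 τ hτ]; exact hi
  have hderS : ∀ τ ∈ S, ∀ (ℓ : M.E i →L[ℝ] ℝ) a,
      fderiv ℝ (fun y => ℓ (M.chart i (G y))) (0, τ) (a, 0) = ℓ (L a) := fun τ hτ ℓ a => by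
    have h1 := ((hdiff _ (hmemΩ τ (subset_closure hτ)) ℓ).differentiableAt one_ne_zero).hasFDerivAt
    have h2 : HasFDerivAt (fun u : Fin (d + 1) → ℝ => (u, τ)) (ContinuousLinearMap.inl ℝ _ ℝ) 0 :=
      hasFDerivAt_prodMk_left 0 τ
    have h3 := h1.comp (f := fun u : Fin (d + 1) → ℝ => (u, τ)) 0 h2
    have h4 : HasFDerivAt (fun u => ℓ (M.chart i x) + (ℓ.comp L) u) (ℓ.comp L) 0 :=
      (ℓ.comp L).hasFDerivAt.const_add _
    have h5 := h4.unique (h3.congr_of_eventuallyEq (by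
      filter_upwards [hτ, hPchart] with u hu hu'
      simp only [Function.comp_apply, hu, hu', map_add, ContinuousLinearMap.comp_apply]))
    exact (congrArg (fun T : (Fin (d + 1) → ℝ) →L[ℝ] ℝ => T a) h5).symm
  have hder : ∀ τ ∈ closure S, ∀ (ℓ : M.E i →L[ℝ] ℝ) a,
      fderiv ℝ (fun y => ℓ (M.chart i (G y))) (0, τ) (a, 0) = ℓ (L a) := fun τ hτ ℓ a => by
    -- Continuity of the derivative carries the value `ℓ (L a)` over to limit times.
    have h1 : ContinuousAt (fun s : ℝ => fderiv ℝ (fun y => ℓ (M.chart i (G y))) (0, s) (a, 0)) τ :=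
      (((hdiff _ (hmemΩ τ hτ) ℓ).continuousAt_fderiv one_ne_zero).comp
        (f := fun s : ℝ => ((0 : Fin (d + 1) → ℝ), s)) (by fun_prop)).clm_apply continuousAt_const
    have := mem_closure_iff_nhdsWithin_neBot.1 hτ
    refine tendsto_nhds_unique (h1.tendsto.mono_left nhdsWithin_le_nhds)
      (tendsto_const_nhds.congr' ?_ : Tendsto _ (𝓝[S] τ) _)
    filter_upwards [self_mem_nhdsWithin] with s hs
    exact (hderS s hs ℓ a).symm
  have hnhds : ∀ τ ∈ closure S, S ∈ 𝓝 τ := fun τ hτ => by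
    obtain ⟨ε, hε, hball⟩ := exists_ball_eq_of_fderiv_kernel (φ := fun z => M.chart i (G z))
      ((isOpen_preimage_chart_source hG i).mem_nhds (hmemΩ τ hτ)) hdiff
      (fun z hz k => exists_fderiv_homotopy_eq_zero hF hP hd₀ hz k) (ℓ := ℓ) fun k j => by
        rw [hder τ hτ (ℓ j), ← hℓ k j]
        simp [L]
    -- In the chart `G` is independent of time on the ball, so the agreement with `P` at the single
    -- time `s ∈ S` spreads to all times of the ball.
    obtain ⟨s, hs, hsS⟩ := Metric.mem_closure_iff.1 hτ ε hε
    refine mem_of_superset (Metric.ball_mem_nhds τ hε) fun τ' hτ' => ?_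
    filter_upwards [hs, Metric.ball_mem_nhds 0 hε] with u hu hu0
    have hsball : s ∈ Metric.ball τ ε := by rwa [Metric.mem_ball, dist_comm]
    rw [← hu]
    exact (M.chart i).injOn (hball u hu0 τ' hτ').1 (hball u hu0 s hsball).1
      ((hball u hu0 τ' hτ').2 s hsball)
  have hclopen : IsClopen S :=
    ⟨closure_subset_iff_isClosed.1 fun τ hτ => mem_of_mem_nhds (hnhds τ hτ),
      isOpen_iff_mem_nhds.2 fun τ hτ => hnhds τ (subset_closure hτ)⟩
  have huniv := hclopen.eq_univ ⟨1, Eventually.of_forall fun u => hF1 (P u)⟩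
  have ht : t ∈ S := huniv ▸ mem_univ t
  have h : F (P 0, t) = P 0 := ht.self_of_nhds
  rw [hP0] at h
  exact h

theorem dDiffeomorphic_skeleton_of_smoothlyHomotopyEquivalent {N : CInftyManifold.{u', v', w'}}
    (hd₀ : 0 < d) (hdM : (d : ℕ∞) < M.dim) (hdN : (d : ℕ∞) < N.dim)
    (h : SmoothlyHomotopyEquivalent (Skeleton d M) (Skeleton d N)) :
    DDiffeomorphic (Skeleton d M) (Skeleton d N) := by
  obtain ⟨f, g, hf, hg, ⟨F, hF, hF0, hF1⟩, ⟨F', hF', hF'0, hF'1⟩⟩ := h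
  exact ⟨⟨f, g, fun x => (hF0 x).symm.trans (homotopy_skeleton_eq_of_eq_id hd₀ hdM hF hF1 x 0),
    fun y => (hF'0 y).symm.trans (homotopy_skeleton_eq_of_eq_id hd₀ hdN hF' hF'1 y 0)⟩, hf, hg⟩

end CInftyManifold

theorem corollary1p4 (M : CInftyManifold.{u, v, w}) (N : CInftyManifold.{u', v', w'})
    (d : ℕ) (hd₀ : 0 < d) (hd : (d : ℕ∞) < min M.dim N.dim) :
    List.TFAE [
      SmoothlyHomotopyEquivalent (Skeleton d M) (Skeleton d N),
      DDiffeomorphic (Skeleton d M) (Skeleton d N),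
      CInftyManifold.Diffeomorphic M N] := by
  obtain ⟨hdM, hdN⟩ := lt_min_iff.1 hd
  tfae_have 1 → 2 :=
    CInftyManifold.dDiffeomorphic_skeleton_of_smoothlyHomotopyEquivalent hd₀ hdM hdN
  tfae_have 2 → 3 := CInftyManifold.diffeomorphic_of_dDiffeomorphic_skeleton hd₀
  tfae_have 3 → 2 := fun h => h.dDiffeomorphic_skeleton d
  tfae_have 2 → 1 := fun h => h.smoothlyHomotopyEquivalent
  tfae_finish
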